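/- Let $X$ and $Y$ be zero-mean, jointly Gaussian random vectors with values in $\mathbb R^{n_x}$ and $\mathbb R^{n_y}$, with covariance matrices $\Sigma_X,\Sigma_Y\succ 0$ and cross-covariance $\Sigma_{XY}$. Let $X^*=\mathbb E[X\mid Y]$, with covariance matrix $\Sigma_{X^*}$ (possibly singular), and let $\Sigma_{X^*}^{\dagger}$ be its Moore–Penrose pseudo-inverse. Square roots of positive semidefinite matrices are the positive semidefinite ones. An estimator of $X$ from $Y$ is a conditional distribution $p_{\hat X\mid Y}$ (a Markov kernel), where $\hat X$ is independent of $X$ given $Y$. Its perception index is $W_2(p_X,p_{\hat X})$, where $W_2$ is the Wasserstein-2 distance for the Euclidean norm, its MSE is $\mathbb E\|X-\hat X\|^2$, and $$D(P)=\inf_{p_{\hat X\mid Y}}\bigl\{\mathbb E\|X-\hat X\|^2 : W_2(p_X,p_{\hat X})\le P\bigr\}.$$ Put $$G^*=\Bigl(\mathrm{Tr}\bigl\{\Sigma_X+\Sigma_{X^*}-2(\Sigma_X^{1/2}\Sigma_{X^*}\Sigma_X^{1/2})^{1/2}\bigr\}\Bigr)^{1/2},\qquad T^*=\Sigma_X^{-1/2}(\Sigma_X^{1/2}\Sigma_{X^*}\Sigma_X^{1/2})^{1/2}\Sigma_X^{-1/2},$$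 $$\Sigma_W=\Sigma_X^{1/2}\bigl(I-\Sigma_X^{1/2}T^*\Sigma_{X^*}^{\dagger}T^*\Sigma_X^{1/2}\bigr)\Sigma_X^{1/2}.$$ Then $\Sigma_W\succeq 0$. Moreover, for every $P\in[0,G^*]$, if $W$ is a zero-mean Gaussian vector with covariance $\Sigma_W$, independent of $(X,Y)$, then $$\hat X_P=\Bigl(\bigl(1-\tfrac{P}{G^*}\bigr)\Sigma_X^{1/2}\bigl(\Sigma_X^{1/2}\Sigma_{X^*}\Sigma_X^{1/2}\bigr)^{1/2}\Sigma_X^{-1/2}\Sigma_{X^*}^{\dagger}+\tfrac{P}{G^*}I\Bigr)\Sigma_{XY}\Sigma_Y^{-1}Y+\bigl(1-\tfrac{P}{G^*}\bigr)W$$ is an estimator of $X$ from $Y$ (its conditional distribution given $(X,Y)$ depends only on $Y$) with perception index exactly $W_2(p_X,p_{\hat X_P})=P$ and MSE $\mathbb E\|X-\hat X_P\|^2=D(P)$. The conditional distribution of $\hat X_P$ given $Y=y$ is the law of the right-hand side with $Y$ replaced by $y$. If $G^*=0$ (so $P=0$), the quotient $P/G^*$ is read as $0$. -/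

import Mathlib

open MeasureTheory ProbabilityTheory Matrix
open scoped ENNReal MatrixOrder

noncomputable section

namespace DistortionPerception

/-- `ℝⁿ` with its Euclidean norm. -/
abbrev E (n : ℕ) : Type := EuclideanSpace ℝ (Fin n)

/-! ### Wasserstein distance -/

/-- `IsCoupling p q ν`: `ν` is a joint law with marginals `p` and `q`. -/
def IsCoupling {n : ℕ} (p q : Measure (E n)) (ν : Measure (E n × E n)) : Prop :=
  ν.map Prod.fst = p ∧ ν.map Prod.snd = q

/-- The Wasserstein-2 distance, with values in `[0, ∞]`. -/
def W2 {n : ℕ} (p q : Measure (E n)) : ℝ≥0∞ :=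
  (⨅ (ν : Measure (E n × E n)) (_ : IsCoupling p q ν), ∫⁻ z, ‖z.1 - z.2‖ₑ ^ 2 ∂ν) ^ (1 / 2 : ℝ)

/-! ### Estimators and the distortion-perception function

An estimator of `X` from `Y` is a conditional distribution of the estimate given `Y`, that is, a
Markov kernel `κ`; the estimate is conditionally independent of `X` given `Y`. -/

section Estimators

variable {Ω : Type*} [MeasurableSpace Ω] {m n : ℕ}

/-- The law of the estimate produced by the estimator `κ` from `Y`. -/
def outputLaw (κ : Kernel (E n) (E m)) (Y : Ω → E n) (μ : Measure Ω) : Measure (E m) :=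
  (μ.map Y).bind κ

/-- The mean squared error of the estimator `κ`: given `ω`, the estimate is drawn from
`κ (Y ω)`, independently of `X ω`. -/
def kernelMSE (κ : Kernel (E n) (E m)) (X : Ω → E m) (Y : Ω → E n) (μ : Measure Ω) : ℝ≥0∞ :=
  ∫⁻ ω, ∫⁻ z, ‖X ω - z‖ₑ ^ 2 ∂(κ (Y ω)) ∂μ

/-- The distortion-perception function `D(P)`. -/
def DP (X : Ω → E m) (Y : Ω → E n) (μ : Measure Ω) (P : ℝ) : ℝ≥0∞ :=
  ⨅ (κ : Kernel (E n) (E m)) (_ : IsMarkovKernel κ)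
    (_ : W2 (μ.map X) (outputLaw κ Y μ) ≤ ENNReal.ofReal P), kernelMSE κ X Y μ

/-- The random vector `Xhat` is an estimate of `X` generated by the estimator `κ` from `Y`:
its conditional law given `(X, Y)` is `κ(Y)`. In particular `Xhat` is independent of `X` given `Y`
and has conditional law `κ` given `Y`. -/
def IsGeneratedBy (Xhat : Ω → E m) (κ : Kernel (E n) (E m)) (X : Ω → E m) (Y : Ω → E n)
    (μ : Measure Ω) : Prop :=
  μ.map (fun ω => ((X ω, Y ω), Xhat ω)) =
    (μ.map (fun ω => (X ω, Y ω))).compProd (Kernel.prodMkLeft (E m) κ)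

end Estimators

/-! ### Matrices -/

/-- The positive semidefinite square root of a positive semidefinite matrix. -/
abbrev msqrt {n : ℕ} (A : Matrix (Fin n) (Fin n) ℝ) : Matrix (Fin n) (Fin n) ℝ := CFC.sqrt A

/-- The (Moore-Penrose) pseudo-inverse of a symmetric matrix: every nonzero eigenvalue is
inverted, the eigenvalue `0` is kept. -/
def pinv {n : ℕ} (A : Matrix (Fin n) (Fin n) ℝ) : Matrix (Fin n) (Fin n) ℝ :=
  cfc (fun x : ℝ => x⁻¹) A

/-- `pinv` satisfies the four Penrose equations, which characterize the pseudo-inverse. -/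
theorem pinv_penrose {n : ℕ} {A : Matrix (Fin n) (Fin n) ℝ} (hA : A.IsHermitian) :
    A * pinv A * A = A ∧ pinv A * A * pinv A = pinv A ∧
      (A * pinv A)ᵀ = A * pinv A ∧ (pinv A * A)ᵀ = pinv A * A := by
  have hA' : IsSelfAdjoint A := hA
  have hc (f : ℝ → ℝ) : ContinuousOn f (spectrum ℝ A) :=
    (Matrix.finite_real_spectrum (A := A)).continuousOn f
  have hid : cfc (fun x : ℝ => x) A = A := cfc_id' ℝ A
  have h1 : A * pinv A = cfc (fun x : ℝ => x * x⁻¹) A := by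
    rw [cfc_mul _ _ A (hc _) (hc _), hid, pinv]
  have h2 : pinv A * A = cfc (fun x : ℝ => x * x⁻¹) A := by
    rw [← h1, pinv]
    nth_rewrite 2 [← hid]
    nth_rewrite 3 [← hid]
    exact (cfc_commute_cfc _ _ A).eq
  have hT : (cfc (fun x : ℝ => x * x⁻¹) A)ᵀ = cfc (fun x : ℝ => x * x⁻¹) A := by
    have h : IsSelfAdjoint (cfc (fun x : ℝ => x * x⁻¹) A) := cfc_predicate _ A
    rw [← Matrix.conjTranspose_eq_transpose_of_trivial]
    exact h
  refine ⟨?_, ?_, by rw [h1, hT], by rw [h2, hT]⟩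
  · rw [h1]
    nth_rewrite 2 [← hid]
    rw [← cfc_mul _ _ A (hc _) (hc _)]
    refine Eq.trans ?_ hid
    congr 1
    funext x
    by_cases hx : x = 0 <;> simp [hx]
  · rw [h2, pinv, ← cfc_mul _ _ A (hc _) (hc _)]
    congr 1
    funext x
    by_cases hx : x = 0 <;> simp [hx]

/-- The product of a matrix and a vector of a Euclidean space. -/
def mulVecE {m n : ℕ} (A : Matrix (Fin m) (Fin n) ℝ) (v : E n) : E m :=
  WithLp.toLp 2 (A *ᵥ v.ofLp)

/-- `T* = Σ_X^{-1/2} (Σ_X^{1/2} Σ_{X*} Σ_X^{1/2})^{1/2} Σ_X^{-1/2}` for `S = Σ_X`,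
`S' = Σ_{X*}`. -/
def transport {n : ℕ} (S S' : Matrix (Fin n) (Fin n) ℝ) : Matrix (Fin n) (Fin n) ℝ :=
  (msqrt S)⁻¹ * msqrt (msqrt S * S' * msqrt S) * (msqrt S)⁻¹

/-- The Gelbrich distance of two centred laws with covariances `S`, `S'`. -/
def gelbrich {n : ℕ} (S S' : Matrix (Fin n) (Fin n) ℝ) : ℝ :=
  Real.sqrt (Matrix.trace (S + S' - (2 : ℝ) • msqrt (msqrt S * S' * msqrt S)))

/-- `Σ_W = Σ_X^{1/2} (I - Σ_X^{1/2} T* Σ_{X*}^† T* Σ_X^{1/2}) Σ_X^{1/2}` for `S = Σ_X`,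
`S' = Σ_{X*}`. -/
def noiseCov {n : ℕ} (S S' : Matrix (Fin n) (Fin n) ℝ) : Matrix (Fin n) (Fin n) ℝ :=
  msqrt S * (1 - msqrt S * transport S S' * pinv S' * transport S S' * msqrt S) * msqrt S

/-- The matrix of the linear part of the estimator, for the weight `t`:
`((1 - t) Σ_X^{1/2} (Σ_X^{1/2} Σ_{X*} Σ_X^{1/2})^{1/2} Σ_X^{-1/2} Σ_{X*}^† + t I) Σ_XY Σ_Y^{-1}`,
where `S = Σ_X`, `S' = Σ_{X*}`, `C = Σ_XY`, `R = Σ_Y`. -/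
def gain {m n : ℕ} (S S' : Matrix (Fin m) (Fin m) ℝ) (C : Matrix (Fin m) (Fin n) ℝ)
    (R : Matrix (Fin n) (Fin n) ℝ) (t : ℝ) : Matrix (Fin m) (Fin n) ℝ :=
  ((1 - t) • (msqrt S * msqrt (msqrt S * S' * msqrt S) * (msqrt S)⁻¹ * pinv S')
    + t • (1 : Matrix (Fin m) (Fin m) ℝ)) * C * R⁻¹

/-! ### The Gaussian setting -/

section Gaussian

variable {Ω : Type*} [MeasurableSpace Ω] {m n : ℕ}

/-- The cross-covariance matrix `Σ_UV`. -/
def covMat (U : Ω → E m) (V : Ω → E n) (μ : Measure Ω) : Matrix (Fin m) (Fin n) ℝ :=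
  Matrix.of fun i j => cov[fun ω => U ω i, fun ω => V ω j; μ]

/-- The minimum mean squared error estimator `X* = E[X | Y]`. -/
def Xstar (X : Ω → E m) (Y : Ω → E n) (μ : Measure Ω) : Ω → E m :=
  μ[X | MeasurableSpace.comap Y inferInstance]

/-- The covariance matrix `Σ_{X*}` of `X*`. -/
def covStar (X : Ω → E m) (Y : Ω → E n) (μ : Measure Ω) : Matrix (Fin m) (Fin m) ℝ :=
  covMat (Xstar X Y μ) (Xstar X Y μ) μ

/-- `G*`, the Gelbrich distance of `X` and `X*`. -/
def Gstar (X : Ω → E m) (Y : Ω → E n) (μ : Measure Ω) : ℝ :=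
  gelbrich (covMat X X μ) (covStar X Y μ)

/-- The noise covariance `Σ_W`. -/
def covW (X : Ω → E m) (Y : Ω → E n) (μ : Measure Ω) : Matrix (Fin m) (Fin m) ℝ :=
  noiseCov (covMat X X μ) (covStar X Y μ)

/-- The linear map plus noise `(y, w) ↦ A_P y + (1 - P / G*) w`, which defines the estimator
`Xhat_P` from `y = Y` and the noise `w = W`. -/
def estimate (X : Ω → E m) (Y : Ω → E n) (μ : Measure Ω) (P : ℝ) (y : E n) (w : E m) : E m :=
  mulVecE (gain (covMat X X μ) (covStar X Y μ) (covMat X Y μ) (covMat Y Y μ) (P / Gstar X Y μ)) y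
    + (1 - P / Gstar X Y μ) • w

/-- The estimator as a conditional distribution: given `Y = y`, the law of `estimate X Y μ P y W`
for a Gaussian `W` with mean zero and covariance `Σ_W`. -/
def estimatorKernel (X : Ω → E m) (Y : Ω → E n) (μ : Measure Ω) (P : ℝ) : Kernel (E n) (E m) :=
  Kernel.map (Kernel.prod Kernel.id (Kernel.const (E n) (multivariateGaussian 0 (covW X Y μ))))
    (fun z : E n × E m => estimate X Y μ P z.1 z.2)

/-- `W` is a zero-mean Gaussian noise with covariance `Σ_W`, independent of `(X, Y)`. -/
structure IsNoise (W : Ω → E m) (X : Ω → E m) (Y : Ω → E n) (μ : Measure Ω) : Prop where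
  gaussian : HasGaussianLaw W μ
  mean_zero : μ[W] = 0
  cov_eq : covMat W W μ = covW X Y μ
  indep : IndepFun W (fun ω => (X ω, Y ω)) μ

end Gaussian

end DistortionPerception

end

namespace DistortionPerception

/-! ### Basic properties of the Wasserstein distance -/

section Wasserstein

variable {Ω : Type*} [MeasurableSpace Ω] {m : ℕ}

/-! The problem is a triangle inequality that becomes an equality along a segment. Write S for
`covMat X X μ`, S' for `covStar X Y μ`, T for `transport S S'` and K for `regression X Y μ`. Joint
Gaussianity makes X - KY independent of Y, so X* = KY almost surely, and the error of any estimator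
splits as E‖X - X*‖² + E‖X* - X̂‖² (`kernelMSE_eq_add`). Only the second term depends on the
estimator.

Lower bound: its root is at least W2(X*, X̂) ≥ W2(X, X*) - W2(X, X̂) ≥ G* - P, by `W2_triangle` and
the Gelbrich bound `gelbrich_le_W2`.

Attainment: put L = S T S'^† and X̂_0 = L X* + W. Since T S T = S', the noise covariance is exactly
what L S' Lᵀ lacks to reach S (`gain_cov_add_noiseCov`), so X̂_0 has the law of X; moreover E‖X̂_0 -
X*‖² = G*² (`trace_gap`). By `estimate_eq`, X̂_P is the point of the segment from X̂_0 to X* with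
weight P / G*. Its L² distances to the endpoints are P and G* - P. The first bounds the perception
index by P, the second meets the lower bound for the error, and the triangle inequality excludes an
index below P. -/

lemma rpow_half_sq (a : ℝ≥0∞) : (a ^ 2) ^ (1 / 2 : ℝ) = a := by
  rw [← ENNReal.rpow_natCast, ← ENNReal.rpow_mul]
  norm_num

lemma rpow_sq_half (a : ℝ≥0∞) : (a ^ (1 / 2 : ℝ)) ^ 2 = a := by
  rw [← ENNReal.rpow_natCast, ← ENNReal.rpow_mul]
  norm_num

lemma W2_le_of_isCoupling {p q : Measure (E m)} {ν : Measure (E m × E m)} (h : IsCoupling p q ν) :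
    W2 p q ≤ (∫⁻ z, ‖z.1 - z.2‖ₑ ^ 2 ∂ν) ^ (1 / 2 : ℝ) :=
  ENNReal.rpow_le_rpow (iInf₂_le ν h) (by norm_num)

lemma le_W2 {p q : Measure (E m)} {a : ℝ≥0∞}
    (h : ∀ ν, IsCoupling p q ν → a ^ 2 ≤ ∫⁻ z, ‖z.1 - z.2‖ₑ ^ 2 ∂ν) : a ≤ W2 p q := by
  have h2 : a ^ 2 ≤ ⨅ (ν : Measure (E m × E m)) (_ : IsCoupling p q ν),
      ∫⁻ z, ‖z.1 - z.2‖ₑ ^ 2 ∂ν := le_iInf₂ h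
  rw [← rpow_half_sq a]
  exact ENNReal.rpow_le_rpow h2 (by norm_num)

lemma isCoupling_map {μ : Measure Ω} {U V : Ω → E m} (hU : AEMeasurable U μ)
    (hV : AEMeasurable V μ) : IsCoupling (μ.map U) (μ.map V) (μ.map fun ω => (U ω, V ω)) := by
  constructor
  · rw [AEMeasurable.map_map_of_aemeasurable measurable_fst.aemeasurable (hU.prodMk hV)]
    rfl
  · rw [AEMeasurable.map_map_of_aemeasurable measurable_snd.aemeasurable (hU.prodMk hV)]
    rfl

/-- Random vectors on a common probability space bound the Wasserstein distance of their laws. -/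
lemma W2_map_le {μ : Measure Ω} {U V : Ω → E m} (hU : AEMeasurable U μ) (hV : AEMeasurable V μ) :
    W2 (μ.map U) (μ.map V) ≤ (∫⁻ ω, ‖U ω - V ω‖ₑ ^ 2 ∂μ) ^ (1 / 2 : ℝ) := by
  refine (W2_le_of_isCoupling (isCoupling_map hU hV)).trans_eq ?_
  rw [lintegral_map' (Measurable.aemeasurable (by fun_prop)) (hU.prodMk hV)]

lemma W2_comm_le (p q : Measure (E m)) : W2 q p ≤ W2 p q := by
  refine ENNReal.rpow_le_rpow (le_iInf₂ fun ν hν => ?_) (by norm_num)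
  have hc : IsCoupling q p (ν.map Prod.swap) := by
    refine ⟨?_, ?_⟩
    · rw [Measure.map_map measurable_fst measurable_swap]; exact hν.2
    · rw [Measure.map_map measurable_snd measurable_swap]; exact hν.1
  refine (iInf₂_le _ hc).trans_eq ?_
  rw [lintegral_map (by fun_prop) measurable_swap]
  simp_rw [Prod.fst_swap, Prod.snd_swap, enorm_sub_rev]

lemma W2_comm (p q : Measure (E m)) : W2 p q = W2 q p :=
  le_antisymm (W2_comm_le q p) (W2_comm_le p q)

/-- Gluing of two couplings along their common marginal. -/
lemma exists_gluing {p q r : Measure (E m)} [IsProbabilityMeasure q] {ν ν' : Measure (E m × E m)}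
    (h : IsCoupling p q ν) (h' : IsCoupling q r ν') :
    ∃ γ : Measure ((E m × E m) × E m), γ.map Prod.fst = ν ∧
      γ.map (fun z => (z.1.2, z.2)) = ν' := by
  have hν' : IsProbabilityMeasure ν' := by
    have : IsProbabilityMeasure (ν'.map Prod.fst) := by rw [h'.1]; infer_instance
    exact Measure.isProbabilityMeasure_of_map Prod.fst
  have hν : IsProbabilityMeasure ν := by
    have : IsProbabilityMeasure (ν.map Prod.snd) := by rw [h.2]; infer_instance
    exact Measure.isProbabilityMeasure_of_map Prod.snd
  -- The pair is drawn from `ν`, then the third point from the conditional law of `ν'` given the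
  -- middle one.
  refine ⟨ν ⊗ₘ (ν'.condKernel.comap Prod.snd measurable_snd), ?_, ?_⟩
  · exact Measure.fst_compProd _ _
  · have hd : ν' = q ⊗ₘ ν'.condKernel := by
      rw [← h'.1]; exact (ν'.disintegrate ν'.condKernel).symm
    conv_rhs => rw [hd, ← h.2]
    ext s hs
    have hg : Measurable fun z : (E m × E m) × E m => (z.1.2, z.2) := by fun_prop
    rw [Measure.map_apply hg hs, Measure.compProd_apply (hg hs),
      Measure.compProd_apply hs, lintegral_map (Kernel.measurable_kernel_prodMk_left hs)
        measurable_snd]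
    rfl

/-- Minkowski's inequality in L² on the glued space, for arbitrary couplings, so that no optimal
coupling has to exist. -/
lemma W2_triangle (p q r : Measure (E m)) [IsProbabilityMeasure q] :
    W2 p r ≤ W2 p q + W2 q r := by
  have key : ∀ ν, IsCoupling p q ν → ∀ ν', IsCoupling q r ν' →
      W2 p r ≤ (∫⁻ z, ‖z.1 - z.2‖ₑ ^ 2 ∂ν) ^ (1 / 2 : ℝ)
        + (∫⁻ z, ‖z.1 - z.2‖ₑ ^ 2 ∂ν') ^ (1 / 2 : ℝ) := by
    intro ν hν ν' hν'
    obtain ⟨γ, h1, h2⟩ := exists_gluing hν hν'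
    have hp : γ.map (fun z => z.1.1) = p := by
      rw [← hν.1, ← h1, Measure.map_map measurable_fst measurable_fst]; rfl
    have hr : γ.map (fun z => z.2) = r := by
      rw [← hν'.2, ← h2, Measure.map_map measurable_snd (by fun_prop)]; rfl
    rw [← h1, ← h2, lintegral_map (by fun_prop) measurable_fst,
      lintegral_map (by fun_prop) (by fun_prop), ← hp, ← hr]
    refine (W2_map_le (by fun_prop) (by fun_prop)).trans ?_
    refine le_trans ?_ (ENNReal.lintegral_Lp_add_le (p := 2) (μ := γ)
      (f := fun z => ‖z.1.1 - z.1.2‖ₑ) (g := fun z => ‖z.1.2 - z.2‖ₑ)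
      (by fun_prop) (by fun_prop) (by norm_num) |>.trans_eq ?_)
    · refine ENNReal.rpow_le_rpow (lintegral_mono fun z => ?_) (by norm_num)
      rw [← ENNReal.rpow_natCast, Nat.cast_ofNat]
      refine ENNReal.rpow_le_rpow ?_ (by norm_num)
      calc ‖z.1.1 - z.2‖ₑ = ‖(z.1.1 - z.1.2) + (z.1.2 - z.2)‖ₑ := by congr 1; abel
        _ ≤ _ := enorm_add_le _ _
    · norm_num
  -- The square root is an order isomorphism of [0, ∞], so it moves inside the infimum; sums of
  -- infima can then be compared coupling by coupling.
  have hinf : ∀ p q : Measure (E m), W2 p q =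
      ⨅ (ν : Measure (E m × E m)) (_ : IsCoupling p q ν),
        (∫⁻ z, ‖z.1 - z.2‖ₑ ^ 2 ∂ν) ^ (1 / 2 : ℝ) := by
    intro p q
    have := (ENNReal.orderIsoRpow (1 / 2 : ℝ) (by norm_num)).map_iInf₂
      (fun (ν : Measure (E m × E m)) (_ : IsCoupling p q ν) => ∫⁻ z, ‖z.1 - z.2‖ₑ ^ 2 ∂ν)
    simpa only [ENNReal.orderIsoRpow_apply, W2] using this
  rw [hinf p q, hinf q r]
  simp_rw [ENNReal.iInf_add, ENNReal.add_iInf]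
  exact le_iInf₂ fun ν hν => le_iInf₂ fun ν' hν' => key ν hν ν' hν'

end Wasserstein

/-! ### Linear maps and covariance matrices -/

section Covariance

variable {Ω : Type*} [MeasurableSpace Ω] {k l m n : ℕ}

/-- `mulVecE A` as a continuous linear map. -/
noncomputable def mulVecCLM (A : Matrix (Fin m) (Fin n) ℝ) : E n →L[ℝ] E m :=
  LinearMap.toContinuousLinearMap
    { toFun := mulVecE A
      map_add' := fun x y => by simp [mulVecE, Matrix.mulVec_add]
      map_smul' := fun c x => by simp [mulVecE, Matrix.mulVec_smul] }

@[fun_prop]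
lemma continuous_mulVecE (A : Matrix (Fin m) (Fin n) ℝ) : Continuous (mulVecE A) :=
  (mulVecCLM A).continuous

@[fun_prop]
lemma measurable_mulVecE (A : Matrix (Fin m) (Fin n) ℝ) : Measurable (mulVecE A) :=
  (continuous_mulVecE A).measurable

lemma mulVecE_mul (A : Matrix (Fin l) (Fin m) ℝ) (B : Matrix (Fin m) (Fin n) ℝ) (x : E n) :
    mulVecE (A * B) x = mulVecE A (mulVecE B x) := by
  simp [mulVecE, Matrix.mulVec_mulVec]

lemma mulVecE_add_left (A B : Matrix (Fin m) (Fin n) ℝ) (x : E n) :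
    mulVecE (A + B) x = mulVecE A x + mulVecE B x := by
  simp [mulVecE, Matrix.add_mulVec]

lemma mulVecE_sub_left (A B : Matrix (Fin m) (Fin n) ℝ) (x : E n) :
    mulVecE (A - B) x = mulVecE A x - mulVecE B x := by
  simp [mulVecE, Matrix.sub_mulVec]

lemma mulVecE_smul_left (c : ℝ) (A : Matrix (Fin m) (Fin n) ℝ) (x : E n) :
    mulVecE (c • A) x = c • mulVecE A x := by
  simp [mulVecE, Matrix.smul_mulVec]

lemma mulVecE_one (x : E n) : mulVecE (1 : Matrix (Fin n) (Fin n) ℝ) x = x := by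
  simp [mulVecE]

lemma inner_mulVecE (A : Matrix (Fin m) (Fin n) ℝ) (x : E m) (y : E n) :
    inner ℝ x (mulVecE A y) = inner ℝ (mulVecE Aᵀ x) y := by
  simp only [EuclideanSpace.inner_eq_star_dotProduct, mulVecE, star_trivial]
  rw [Matrix.mulVec_transpose, dotProduct_comm, Matrix.dotProduct_mulVec, dotProduct_comm]

lemma memLp_coord {μ : Measure Ω} {U : Ω → E m} (hU : MemLp U 2 μ) (i : Fin m) :
    MemLp (fun ω => U ω i) 2 μ :=
  hU.continuousLinearMap_comp (EuclideanSpace.proj i : E m →L[ℝ] ℝ)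

lemma memLp_mulVecE {μ : Measure Ω} {U : Ω → E n} (hU : MemLp U 2 μ)
    (A : Matrix (Fin m) (Fin n) ℝ) : MemLp (fun ω => mulVecE A (U ω)) 2 μ :=
  hU.continuousLinearMap_comp (mulVecCLM A)

lemma integral_mulVecE {μ : Measure Ω} {U : Ω → E n} (hU : Integrable U μ)
    (A : Matrix (Fin m) (Fin n) ℝ) : ∫ ω, mulVecE A (U ω) ∂μ = mulVecE A (∫ ω, U ω ∂μ) :=
  (mulVecCLM A).integral_comp_comm hU

lemma integral_coord {μ : Measure Ω} {U : Ω → E m} (hU : Integrable U μ) (i : Fin m) :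
    ∫ ω, U ω i ∂μ = (∫ ω, U ω ∂μ) i :=
  (EuclideanSpace.proj i : E m →L[ℝ] ℝ).integral_comp_comm hU

lemma covMat_transpose (U : Ω → E m) (V : Ω → E n) (μ : Measure Ω) :
    (covMat U V μ)ᵀ = covMat V U μ := by
  ext i j
  simp [covMat, covariance_comm]

lemma covMat_eq_zero_of_indepFun {μ : Measure Ω} {U : Ω → E m} {V : Ω → E n} (hU : MemLp U 2 μ)
    (hV : MemLp V 2 μ) (h : IndepFun U V μ) : covMat U V μ = 0 := by
  ext i j
  exact (h.comp (φ := fun x : E m => x i) (ψ := fun x : E n => x j) (by fun_prop)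
    (by fun_prop)).covariance_eq_zero (memLp_coord hU i) (memLp_coord hV j)

lemma covMat_congr {μ : Measure Ω} {U U' : Ω → E m} {V V' : Ω → E n}
    (hU : U =ᵐ[μ] U') (hV : V =ᵐ[μ] V') :
    covMat U V μ = covMat U' V' μ := by
  ext i j
  have hi : (fun ω => U ω i) =ᵐ[μ] fun ω => U' ω i := hU.fun_comp fun x => x i
  have hj : (fun ω => V ω j) =ᵐ[μ] fun ω => V' ω j := hV.fun_comp fun x => x j
  simp only [covMat, Matrix.of_apply, covariance]
  rw [integral_congr_ae hi, integral_congr_ae hj]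
  refine integral_congr_ae ?_
  filter_upwards [hi, hj] with ω h h'
  rw [h, h']

lemma covMat_map {Ω' : Type*} [MeasurableSpace Ω'] {ν : Measure Ω'} {Z : Ω' → Ω}
    (hZ : AEMeasurable Z ν) {U : Ω → E m} {V : Ω → E n} (hU : Measurable U) (hV : Measurable V) :
    covMat U V (ν.map Z) = covMat (U ∘ Z) (V ∘ Z) ν := by
  ext i j
  exact covariance_map (Measurable.aestronglyMeasurable (by fun_prop))
    (Measurable.aestronglyMeasurable (by fun_prop)) hZ

lemma lintegral_enorm_sq_eq_ofReal {μ : Measure Ω} {U : Ω → E m} (hU : MemLp U 2 μ) :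
    ∫⁻ ω, ‖U ω‖ₑ ^ 2 ∂μ = ENNReal.ofReal (∫ ω, ‖U ω‖ ^ 2 ∂μ) := by
  rw [ofReal_integral_eq_lintegral_ofReal (hU.integrable_norm_pow (by norm_num))
    (ae_of_all _ fun ω => by positivity)]
  refine lintegral_congr fun ω => ?_
  rw [ENNReal.ofReal_pow (norm_nonneg _), ofReal_norm]

variable {μ : Measure Ω} [IsProbabilityMeasure μ]

lemma covMat_mulVecE_left {U : Ω → E l} {V : Ω → E n} (hU : MemLp U 2 μ) (hV : MemLp V 2 μ)
    (A : Matrix (Fin m) (Fin l) ℝ) :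
    covMat (fun ω => mulVecE A (U ω)) V μ = A * covMat U V μ := by
  ext i j
  simp only [covMat, Matrix.of_apply, Matrix.mul_apply, mulVecE, Matrix.mulVec, dotProduct]
  rw [covariance_fun_sum_left (fun k => (memLp_coord hU k).const_mul _) (memLp_coord hV j)]
  simp_rw [covariance_const_mul_left]

lemma covMat_mulVecE_right {U : Ω → E l} {V : Ω → E n} (hU : MemLp U 2 μ) (hV : MemLp V 2 μ)
    (A : Matrix (Fin m) (Fin n) ℝ) :
    covMat U (fun ω => mulVecE A (V ω)) μ = covMat U V μ * Aᵀ := by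
  rw [← covMat_transpose, covMat_mulVecE_left hV hU, Matrix.transpose_mul, covMat_transpose]

lemma covMat_mulVecE {U : Ω → E n} (hU : MemLp U 2 μ) (A : Matrix (Fin m) (Fin n) ℝ) :
    covMat (fun ω => mulVecE A (U ω)) (fun ω => mulVecE A (U ω)) μ = A * covMat U U μ * Aᵀ := by
  rw [covMat_mulVecE_left hU (memLp_mulVecE hU A), covMat_mulVecE_right hU hU, Matrix.mul_assoc]

lemma covMat_add_left {U U' : Ω → E m} {V : Ω → E n} (hU : MemLp U 2 μ) (hU' : MemLp U' 2 μ)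
    (hV : MemLp V 2 μ) :
    covMat (fun ω => U ω + U' ω) V μ = covMat U V μ + covMat U' V μ := by
  ext i j
  exact covariance_add_left (memLp_coord hU i) (memLp_coord hU' i) (memLp_coord hV j)

lemma covMat_sub_left {U U' : Ω → E m} {V : Ω → E n} (hU : MemLp U 2 μ) (hU' : MemLp U' 2 μ)
    (hV : MemLp V 2 μ) :
    covMat (fun ω => U ω - U' ω) V μ = covMat U V μ - covMat U' V μ := by
  ext i j
  exact covariance_sub_left (memLp_coord hU i) (memLp_coord hU' i) (memLp_coord hV j)

/-- The covariance of a sum of two independent vectors. -/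
lemma covMat_add_of_indepFun {U V : Ω → E m} (hU : MemLp U 2 μ) (hV : MemLp V 2 μ)
    (h : IndepFun U V μ) :
    covMat (fun ω => U ω + V ω) (fun ω => U ω + V ω) μ = covMat U U μ + covMat V V μ := by
  have h0 : covMat U V μ = 0 := covMat_eq_zero_of_indepFun hU hV h
  have h0' : covMat V U μ = 0 := covMat_eq_zero_of_indepFun hV hU h.symm
  have hUV : MemLp (fun ω => U ω + V ω) 2 μ := hU.add hV
  rw [covMat_add_left hU hV hUV, ← covMat_transpose (fun ω => U ω + V ω) U,
    ← covMat_transpose (fun ω => U ω + V ω) V, covMat_add_left hU hV hU, covMat_add_left hU hV hV,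
    h0, h0']
  simp [covMat_transpose]

/-- The second moment of a centred vector is the trace of its covariance. -/
lemma lintegral_enorm_sq_eq_trace {U : Ω → E m} (hU : MemLp U 2 μ) (h0 : μ[U] = 0) :
    ∫⁻ ω, ‖U ω‖ₑ ^ 2 ∂μ = ENNReal.ofReal (covMat U U μ).trace := by
  rw [lintegral_enorm_sq_eq_ofReal hU]
  congr 1
  simp only [Matrix.trace, Matrix.diag_apply, covMat, Matrix.of_apply]
  simp_rw [EuclideanSpace.norm_sq_eq, Real.norm_eq_abs, sq_abs]
  rw [integral_finsetSum _ fun i _ => (memLp_coord hU i).integrable_sq]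
  refine Finset.sum_congr rfl fun i _ => ?_
  rw [covariance_eq_sub (memLp_coord hU i) (memLp_coord hU i),
    integral_coord (hU.integrable (by norm_num)), h0]
  simp [sq]

/-- Centred Gaussian vectors with the same covariance have the same law. -/
lemma map_eq_multivariateGaussian {U : Ω → E m} (hU : HasGaussianLaw U μ) (h0 : μ[U] = 0)
    {S : Matrix (Fin m) (Fin m) ℝ} (hS : S.PosSemidef) (hcov : covMat U U μ = S) :
    μ.map U = multivariateGaussian 0 S := by
  have hG := hU.isGaussian_map
  refine IsGaussian.ext ?_ ?_
  · rw [integral_map hU.aemeasurable (by fun_prop)]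
    simpa using h0
  · ext x y
    have := covarianceBilin_apply_pi (μ := μ) (fun i => memLp_coord hU.memLp_two i) x y
    rw [covarianceBilin_multivariateGaussian hS, ← hcov]
    refine this.trans ?_
    simp [covMat, Matrix.mulVec, dotProduct, Finset.mul_sum]
    refine Finset.sum_congr rfl fun i _ => Finset.sum_congr rfl fun j _ => by ring

end Covariance

/-! ### The transport matrix and the noise covariance -/

section Matrices

variable {n : ℕ} {S S' : Matrix (Fin n) (Fin n) ℝ}

lemma posSemidef_msqrt (A : Matrix (Fin n) (Fin n) ℝ) : (msqrt A).PosSemidef :=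
  Matrix.nonneg_iff_posSemidef.1 (CFC.sqrt_nonneg A)

lemma transpose_eq_self {A : Matrix (Fin n) (Fin n) ℝ} (hA : A.PosSemidef) : Aᵀ = A := by
  have := hA.isHermitian.eq
  rwa [Matrix.conjTranspose_eq_transpose_of_trivial] at this

lemma msqrt_mul_msqrt {A : Matrix (Fin n) (Fin n) ℝ} (hA : A.PosSemidef) :
    msqrt A * msqrt A = A :=
  CFC.sqrt_mul_sqrt_self A hA.nonneg

lemma transpose_msqrt (A : Matrix (Fin n) (Fin n) ℝ) : (msqrt A)ᵀ = msqrt A :=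
  transpose_eq_self (posSemidef_msqrt A)

lemma transpose_pinv (A : Matrix (Fin n) (Fin n) ℝ) : (pinv A)ᵀ = pinv A := by
  have h : IsSelfAdjoint (pinv A) := cfc_predicate _ A
  rw [← Matrix.conjTranspose_eq_transpose_of_trivial]
  exact h

lemma isUnit_det_msqrt (hS : S.PosDef) : IsUnit (msqrt S).det := by
  have h : (msqrt S).det * (msqrt S).det = S.det := by
    rw [← Matrix.det_mul, msqrt_mul_msqrt hS.posSemidef]
  rw [isUnit_iff_ne_zero]
  intro h0
  rw [h0, zero_mul] at h
  exact hS.det_pos.ne h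

lemma posSemidef_conj (hS' : S'.PosSemidef) (S : Matrix (Fin n) (Fin n) ℝ) :
    (msqrt S * S' * msqrt S).PosSemidef := by
  have h := hS'.mul_mul_conjTranspose_same (msqrt S)
  rwa [Matrix.conjTranspose_eq_transpose_of_trivial, transpose_msqrt] at h

lemma posSemidef_transport (S S' : Matrix (Fin n) (Fin n) ℝ) : (transport S S').PosSemidef := by
  have h := (posSemidef_msqrt (msqrt S * S' * msqrt S)).mul_mul_conjTranspose_same (msqrt S)⁻¹
  rwa [Matrix.conjTranspose_eq_transpose_of_trivial, Matrix.transpose_nonsing_inv,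
    transpose_msqrt] at h

lemma transpose_transport (S S' : Matrix (Fin n) (Fin n) ℝ) :
    (transport S S')ᵀ = transport S S' :=
  transpose_eq_self (posSemidef_transport S S')

/-- This identifies the factor written out in `gain` with S T, the form used in all later
computations. -/
lemma mul_transport (hS : S.PosDef) (S' : Matrix (Fin n) (Fin n) ℝ) :
    S * transport S S' = msqrt S * msqrt (msqrt S * S' * msqrt S) * (msqrt S)⁻¹ := by
  have hu := isUnit_det_msqrt hS
  nth_rewrite 1 [← msqrt_mul_msqrt hS.posSemidef]
  simp only [transport, Matrix.mul_assoc]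
  rw [Matrix.mul_nonsing_inv_cancel_left _ _ hu]

/-- The transport matrix pushes a covariance `S` forward to `S'`. -/
lemma transport_mul_mul_transport (hS : S.PosDef) (hS' : S'.PosSemidef) :
    transport S S' * S * transport S S' = S' := by
  have hu := isUnit_det_msqrt hS
  have hM := msqrt_mul_msqrt (posSemidef_conj hS' S)
  rw [Matrix.mul_assoc, mul_transport hS]
  simp only [transport, Matrix.mul_assoc]
  rw [Matrix.nonsing_inv_mul_cancel_left _ _ hu, ← Matrix.mul_assoc (msqrt (_ * _)),
    ← Matrix.mul_assoc (msqrt S) S', hM]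
  simp only [Matrix.mul_assoc]
  rw [Matrix.nonsing_inv_mul_cancel_left _ _ hu, Matrix.mul_nonsing_inv _ hu, Matrix.mul_one]

/-- The cross term of the Gelbrich distance becomes tr(S T), which is computable from second
moments. -/
lemma trace_mul_transport (hS : S.PosDef) (S' : Matrix (Fin n) (Fin n) ℝ) :
    (S * transport S S').trace = (msqrt (msqrt S * S' * msqrt S)).trace := by
  rw [mul_transport hS, Matrix.trace_mul_comm,
    Matrix.nonsing_inv_mul_cancel_left _ _ (isUnit_det_msqrt hS)]

/-- S' S'^† projects onto the range of S', and this range contains that of T because S' = (T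
S^{1/2})(T S^{1/2})ᵀ with S^{1/2} invertible. Hence the pseudo-inverse cancels next to T even if S'
is singular. -/
lemma mul_pinv_mul_transport (hS : S.PosDef) (hS' : S'.PosSemidef) :
    S' * pinv S' * transport S S' = transport S S' := by
  obtain ⟨h1, -, -, -⟩ := pinv_penrose hS'.isHermitian
  set T := transport S S' with hT
  have hTS : T * S * T = S' := transport_mul_mul_transport hS hS'
  set B := (S' * pinv S' - 1) * T with hB
  -- A real matrix whose product with its own transpose vanishes is zero; here that product reduces
  -- to (S' S'^† - 1) S' = 0 times another factor.
  have hz : (B * msqrt S) * (B * msqrt S)ᵀ = 0 := by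
    have : (B * msqrt S) * (B * msqrt S)ᵀ = (S' * pinv S' - 1) * (T * S * T) *
        (S' * pinv S' - 1)ᵀ := by
      rw [hB]
      nth_rewrite 3 [← msqrt_mul_msqrt hS.posSemidef]
      simp only [Matrix.transpose_mul, transpose_msqrt, hT, transpose_transport, Matrix.mul_assoc]
    rw [this, hTS, Matrix.sub_mul, h1, Matrix.one_mul, sub_self, Matrix.zero_mul]
  rw [← Matrix.conjTranspose_eq_transpose_of_trivial, Matrix.self_mul_conjTranspose_eq_zero] at hz
  have hB0 : B = 0 := by
    have := congrArg (· * (msqrt S)⁻¹) hz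
    simpa [Matrix.mul_nonsing_inv_cancel_right _ _ (isUnit_det_msqrt hS)] using this
  rw [hB, Matrix.sub_mul, Matrix.one_mul, sub_eq_zero] at hB0
  exact hB0

lemma transport_mul_pinv_mul (hS : S.PosDef) (hS' : S'.PosSemidef) :
    transport S S' * pinv S' * S' = transport S S' := by
  have h := congrArg Matrix.transpose (mul_pinv_mul_transport hS hS')
  simpa [Matrix.transpose_mul, transpose_transport, transpose_pinv, transpose_eq_self hS',
    Matrix.mul_assoc] using h

lemma noiseCov_eq (hS : S.PosDef) (S' : Matrix (Fin n) (Fin n) ℝ) :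
    noiseCov S S' = S - S * transport S S' * pinv S' * transport S S' * S := by
  have h := msqrt_mul_msqrt hS.posSemidef
  calc noiseCov S S' = msqrt S * msqrt S - (msqrt S * msqrt S) * transport S S' * pinv S' *
        transport S S' * (msqrt S * msqrt S) := by
        simp only [noiseCov, Matrix.mul_sub, Matrix.sub_mul, Matrix.mul_one, Matrix.mul_assoc]
    _ = _ := by rw [h]

/-- The subtracted matrix H is an orthogonal projection: it is symmetric, and T S T = S' with S'^†
S' S'^† = S'^† gives H² = H. So 1 - H is its own square and the noise covariance is a Gram matrix.
-/
lemma posSemidef_noiseCov (hS : S.PosDef) (hS' : S'.PosSemidef) : (noiseCov S S').PosSemidef := by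
  obtain ⟨-, h2, -, -⟩ := pinv_penrose hS'.isHermitian
  set H := msqrt S * transport S S' * pinv S' * transport S S' * msqrt S with hH
  have hHT : Hᵀ = H := by
    simp only [hH, Matrix.transpose_mul, transpose_msqrt, transpose_transport, transpose_pinv,
      Matrix.mul_assoc]
  have hHH : H * H = H := by
    calc H * H = msqrt S * transport S S' * pinv S' *
          (transport S S' * (msqrt S * msqrt S) * transport S S') * pinv S' * transport S S' *
            msqrt S := by simp only [hH, Matrix.mul_assoc]
      _ = msqrt S * transport S S' * (pinv S' * S' * pinv S') * transport S S' * msqrt S := by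
          rw [msqrt_mul_msqrt hS.posSemidef, transport_mul_mul_transport hS hS']
          simp only [Matrix.mul_assoc]
      _ = H := by rw [h2]
  have hsq : noiseCov S S' = (msqrt S * (1 - H)) * (msqrt S * (1 - H))ᴴ := by
    rw [Matrix.conjTranspose_eq_transpose_of_trivial, Matrix.transpose_mul, Matrix.transpose_sub,
      hHT, Matrix.transpose_one, transpose_msqrt]
    have : (1 - H) * (1 - H) = 1 - H := by
      simp [Matrix.sub_mul, Matrix.mul_sub, hHH]
    calc noiseCov S S' = msqrt S * ((1 - H) * (1 - H)) * msqrt S := by rw [this]; rfl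
      _ = _ := by simp only [Matrix.mul_assoc]
  rw [hsq]
  exact Matrix.posSemidef_self_mul_conjTranspose _

/-- The covariance of the estimate at perception index zero is `S`. -/
lemma gain_cov_add_noiseCov (hS : S.PosDef) (hS' : S'.PosSemidef) :
    (S * transport S S' * pinv S') * S' * (S * transport S S' * pinv S')ᵀ + noiseCov S S' = S := by
  obtain ⟨-, h2, -, -⟩ := pinv_penrose hS'.isHermitian
  have h : (S * transport S S' * pinv S') * S' * (S * transport S S' * pinv S')ᵀ =
      S * transport S S' * (pinv S' * S' * pinv S') * transport S S' * S := by
    simp only [Matrix.transpose_mul, transpose_transport, transpose_pinv,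
      transpose_eq_self hS.posSemidef, Matrix.mul_assoc]
  rw [h, h2, noiseCov_eq hS]
  abel

/-- The mean squared distance of the MMSE estimate and the estimate at perception index zero. -/
lemma trace_gap (hS : S.PosDef) (hS' : S'.PosSemidef) :
    ((S * transport S S' * pinv S' - 1) * S' * (S * transport S S' * pinv S' - 1)ᵀ
      + noiseCov S S').trace =
      (S + S' - (2 : ℝ) • msqrt (msqrt S * S' * msqrt S)).trace := by
  set L := S * transport S S' * pinv S' with hL
  -- The pseudo-inverse disappears from the cross terms, which are what the expansion leaves besides
  -- S + S'.
  have hLS : L * S' = S * transport S S' := by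
    rw [hL, Matrix.mul_assoc, Matrix.mul_assoc, ← Matrix.mul_assoc (transport S S'),
      transport_mul_pinv_mul hS hS']
  have hSL : S' * Lᵀ = transport S S' * S := by
    have h := congrArg Matrix.transpose hLS
    simpa [Matrix.transpose_mul, transpose_transport, transpose_eq_self hS',
      transpose_eq_self hS.posSemidef] using h
  have h : (L - 1) * S' * (L - 1)ᵀ + noiseCov S S' =
      S + S' - S * transport S S' - transport S S' * S := by
    have h1 := gain_cov_add_noiseCov hS hS'
    rw [← hL] at h1
    have h2 : (L - 1) * S' * (L - 1)ᵀ = L * S' * Lᵀ - L * S' - S' * Lᵀ + S' := by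
      rw [Matrix.transpose_sub, Matrix.transpose_one]; noncomm_ring
    rw [h2, hLS, hSL]
    rw [hLS] at h1
    calc _ = (S * transport S S' * Lᵀ + noiseCov S S') + S' - S * transport S S'
          - transport S S' * S := by abel
      _ = _ := by rw [h1]
  rw [h]
  simp only [Matrix.trace_sub, Matrix.trace_add, Matrix.trace_smul, smul_eq_mul]
  rw [Matrix.trace_mul_comm (transport S S'), trace_mul_transport hS]
  ring

lemma trace_msqrt_mul_mul_msqrt {T : Matrix (Fin n) (Fin n) ℝ} (hT : T.PosSemidef) :
    (msqrt T * S * (msqrt T)ᵀ).trace = (S * T).trace := by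
  rw [transpose_msqrt, Matrix.mul_assoc, Matrix.trace_mul_comm, Matrix.mul_assoc,
    msqrt_mul_msqrt hT]

/-- Second moment of T^{1/2} T^† w for w of covariance T S T. It equals that of T^{1/2} x for x of
covariance S, so the two squares in the Gelbrich bound contribute the same trace. -/
lemma trace_msqrt_pinv {T : Matrix (Fin n) (Fin n) ℝ} (hT : T.PosSemidef) :
    ((msqrt T * pinv T) * (T * S * T) * (msqrt T * pinv T)ᵀ).trace = (S * T).trace := by
  obtain ⟨h1, -, -, -⟩ := pinv_penrose hT.isHermitian
  have h : (msqrt T * pinv T) * (T * S * T) * (msqrt T * pinv T)ᵀ =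
      msqrt T * (pinv T * T * S * T * pinv T) * (msqrt T)ᵀ := by
    simp only [Matrix.transpose_mul, transpose_pinv, Matrix.mul_assoc]
  rw [h, trace_msqrt_mul_mul_msqrt hT]
  calc (pinv T * T * S * T * pinv T * T).trace
      = (pinv T * T * S * (T * pinv T * T)).trace := by simp only [Matrix.mul_assoc]
    _ = (pinv T * T * (S * T)).trace := by rw [h1, Matrix.mul_assoc]
    _ = (S * (T * pinv T * T)).trace := by
        rw [Matrix.trace_mul_comm]; simp only [Matrix.mul_assoc]
    _ = (S * T).trace := by rw [h1]

end Matrices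

/-! ### The Gelbrich bound -/

section Gelbrich

variable {Ω Ω' : Type*} [MeasurableSpace Ω] [MeasurableSpace Ω'] {m n : ℕ}

/-- The sign of the trace is irrelevant: `Real.sqrt` and `ENNReal.ofReal` both send negative numbers
to 0. -/
lemma ofReal_gelbrich_sq (S S' : Matrix (Fin m) (Fin m) ℝ) :
    ENNReal.ofReal (gelbrich S S') ^ 2 =
      ENNReal.ofReal (S + S' - (2 : ℝ) • msqrt (msqrt S * S' * msqrt S)).trace := by
  rw [gelbrich, ← ENNReal.ofReal_pow (Real.sqrt_nonneg _)]
  rcases le_total 0 (S + S' - (2 : ℝ) • msqrt (msqrt S * S' * msqrt S)).trace with h | h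
  · rw [Real.sq_sqrt h]
  · rw [Real.sqrt_eq_zero_of_nonpos h, ENNReal.ofReal_of_nonpos h]
    simp

/-- The hypothesis puts w in the range of T, so w = T^{1/2} u with u = T^{1/2} T^† w. Then ⟨x, w⟩ =
⟨T^{1/2} x, u⟩ and 2⟨a, u⟩ ≤ ‖a‖² + ‖u‖². The additive form avoids truncated subtraction. -/
lemma enorm_sq_add_enorm_sq_le {T : Matrix (Fin m) (Fin m) ℝ} (hT : T.PosSemidef) (x w : E m)
    (hw : mulVecE (1 - T * pinv T) w = 0) :
    ‖x‖ₑ ^ 2 + ‖w‖ₑ ^ 2 ≤ ‖x - w‖ₑ ^ 2 + (‖mulVecE (msqrt T) x‖ₑ ^ 2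
      + ‖mulVecE (msqrt T * pinv T) w‖ₑ ^ 2) := by
  have hwT : w = mulVecE (msqrt T) (mulVecE (msqrt T * pinv T) w) := by
    rw [← mulVecE_mul, ← Matrix.mul_assoc, msqrt_mul_msqrt hT]
    rw [mulVecE_sub_left, mulVecE_one, sub_eq_zero] at hw
    exact hw
  set u := mulVecE (msqrt T * pinv T) w
  have hin : inner ℝ x w = inner ℝ (mulVecE (msqrt T) x) u := by
    rw [hwT, inner_mulVecE, transpose_msqrt]
  have key : ‖x‖ ^ 2 + ‖w‖ ^ 2 ≤ ‖x - w‖ ^ 2 + (‖mulVecE (msqrt T) x‖ ^ 2 + ‖u‖ ^ 2) := by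
    have h1 := norm_sub_sq_real x w
    have h2 := norm_sub_sq_real (mulVecE (msqrt T) x) u
    have h3 := sq_nonneg ‖mulVecE (msqrt T) x - u‖
    rw [hin] at h1
    linarith
  simp only [← ofReal_norm, ← ENNReal.ofReal_pow (norm_nonneg _)]
  rw [← ENNReal.ofReal_add (by positivity) (by positivity),
    ← ENNReal.ofReal_add (by positivity) (by positivity),
    ← ENNReal.ofReal_add (by positivity) (by positivity)]
  exact ENNReal.ofReal_le_ofReal key

/-- The Gelbrich distance is a lower bound for the Wasserstein distance of centred laws. -/
lemma gelbrich_le_W2 {μ : Measure Ω} [IsProbabilityMeasure μ] {μ' : Measure Ω'}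
    [IsProbabilityMeasure μ'] {U : Ω → E m} {V : Ω' → E m} (hU : MemLp U 2 μ) (hV : MemLp V 2 μ')
    (hU0 : μ[U] = 0) (hV0 : μ'[V] = 0) (hS : (covMat U U μ).PosDef)
    (hS' : (covMat V V μ').PosSemidef) :
    ENNReal.ofReal (gelbrich (covMat U U μ) (covMat V V μ')) ≤ W2 (μ.map U) (μ'.map V) := by
  refine le_W2 fun ν hν => ?_
  set S := covMat U U μ with hSdef
  set S' := covMat V V μ' with hS'def
  set T := transport S S'
  have hT : T.PosSemidef := posSemidef_transport S S'
  have hTS : T * S * T = S' := transport_mul_mul_transport hS hS'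
  have hU1 : ∀ A : Matrix (Fin m) (Fin m) ℝ, ∫⁻ z, ‖mulVecE A z.1‖ₑ ^ 2 ∂ν =
      ENNReal.ofReal (A * S * Aᵀ).trace := by
    intro A
    rw [hSdef, ← covMat_mulVecE hU, ← lintegral_enorm_sq_eq_trace (memLp_mulVecE hU A)
      (by rw [integral_mulVecE (hU.integrable (by norm_num)), hU0]; exact map_zero (mulVecCLM A)),
      ← lintegral_map' (f := fun x => ‖mulVecE A x‖ₑ ^ 2) (by fun_prop)
        hU.aestronglyMeasurable.aemeasurable, ← hν.1, lintegral_map (by fun_prop) measurable_fst]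
  have hV1 : ∀ A : Matrix (Fin m) (Fin m) ℝ, ∫⁻ z, ‖mulVecE A z.2‖ₑ ^ 2 ∂ν =
      ENNReal.ofReal (A * S' * Aᵀ).trace := by
    intro A
    rw [hS'def, ← covMat_mulVecE hV, ← lintegral_enorm_sq_eq_trace (memLp_mulVecE hV A)
      (by rw [integral_mulVecE (hV.integrable (by norm_num)), hV0]; exact map_zero (mulVecCLM A)),
      ← lintegral_map' (f := fun x => ‖mulVecE A x‖ₑ ^ 2) (by fun_prop)
        hV.aestronglyMeasurable.aemeasurable, ← hν.2, lintegral_map (by fun_prop) measurable_snd]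
  -- 1 - T T^† annihilates T, hence also S' = T S T. So under every coupling the second coordinate
  -- lies almost surely in the range of T.
  have hae : ∀ᵐ z ∂ν, mulVecE (1 - T * pinv T) z.2 = 0 := by
    have h0 := hV1 (1 - T * pinv T)
    have hz : (1 - T * pinv T) * S' = 0 := by
      rw [← hTS, Matrix.mul_assoc T, ← Matrix.mul_assoc (1 - _), Matrix.sub_mul,
        (pinv_penrose hT.isHermitian).1, Matrix.one_mul, sub_self, Matrix.zero_mul]
    rw [hz, Matrix.zero_mul, Matrix.trace_zero, ENNReal.ofReal_zero,
      lintegral_eq_zero_iff (by fun_prop)] at h0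
    filter_upwards [h0] with z hz
    simpa using hz
  have hle : ∫⁻ z, (‖z.1‖ₑ ^ 2 + ‖z.2‖ₑ ^ 2) ∂ν ≤ ∫⁻ z, (‖z.1 - z.2‖ₑ ^ 2 +
      (‖mulVecE (msqrt T) z.1‖ₑ ^ 2 + ‖mulVecE (msqrt T * pinv T) z.2‖ₑ ^ 2)) ∂ν := by
    refine lintegral_mono_ae ?_
    filter_upwards [hae] with z hz
    exact enorm_sq_add_enorm_sq_le hT z.1 z.2 hz
  have h1 := hU1 1
  have h2 := hV1 1
  simp only [mulVecE_one, Matrix.one_mul, Matrix.transpose_one, Matrix.mul_one] at h1 h2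
  -- Except for the transport cost, every integral depends on one marginal only: tr S + tr S' ≤ cost
  -- + 2 tr(S T).
  rw [lintegral_add_left (by fun_prop), lintegral_add_left (by fun_prop),
    lintegral_add_left (by fun_prop), h1, h2, hU1, hV1, trace_msqrt_mul_mul_msqrt hT, ← hTS,
    trace_msqrt_pinv hT, hTS, trace_mul_transport hS] at hle
  rw [ofReal_gelbrich_sq]
  set M := msqrt (msqrt S * S' * msqrt S)
  have hM : 0 ≤ M.trace := (posSemidef_msqrt _).trace_nonneg
  rw [← ENNReal.ofReal_add hS.posSemidef.trace_nonneg hS'.trace_nonneg,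
    ← ENNReal.ofReal_add hM hM] at hle
  simp only [Matrix.trace_sub, Matrix.trace_add, Matrix.trace_smul, smul_eq_mul]
  rw [ENNReal.ofReal_sub _ (by positivity), two_mul]
  exact tsub_le_iff_right.2 hle

end Gelbrich

/-! ### The minimum mean squared error estimator -/

section MMSE

variable {Ω : Type*} [MeasurableSpace Ω] {m n : ℕ} {μ : Measure Ω} [IsProbabilityMeasure μ]
  {X : Ω → E m} {Y : Ω → E n}

lemma posSemidef_covMat {U : Ω → E m} (hU : MemLp U 2 μ) : (covMat U U μ).PosSemidef := by
  refine Matrix.PosSemidef.of_dotProduct_mulVec_nonneg ?_ fun x => ?_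
  · rw [Matrix.IsHermitian, Matrix.conjTranspose_eq_transpose_of_trivial, covMat_transpose]
  · have h := covarianceBilin_apply_pi (μ := μ) (fun i => memLp_coord hU i)
      (WithLp.toLp 2 x) (WithLp.toLp 2 x)
    have h0 := covarianceBilin_self_nonneg (μ := μ.map fun ω => WithLp.toLp 2 fun i => U ω i)
      (WithLp.toLp 2 x)
    rw [h] at h0
    refine h0.trans_eq ?_
    simp only [covMat, Matrix.mulVec, dotProduct, Finset.mul_sum, Matrix.of_apply, star_trivial]
    exact Finset.sum_congr rfl fun i _ => Finset.sum_congr rfl fun j _ => by ring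

/-- The residual of the linear regression of `X` on `Y` is independent of `Y`. -/
lemma indepFun_residual (hXY : HasGaussianLaw (fun ω => (X ω, Y ω)) μ)
    (hSY : (covMat Y Y μ).PosDef) :
    IndepFun (fun ω => X ω - mulVecE (covMat X Y μ * (covMat Y Y μ)⁻¹) (Y ω)) Y μ := by
  set K := covMat X Y μ * (covMat Y Y μ)⁻¹ with hK
  have hX2 := hXY.fst.memLp_two
  have hY2 := hXY.snd.memLp_two
  have hKY := memLp_mulVecE hY2 K
  have hN2 : MemLp (fun ω => X ω - mulVecE K (Y ω)) 2 μ := hX2.sub hKY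
  -- K solves the normal equations, so the residual is uncorrelated with Y; joint Gaussianity
  -- upgrades this to independence.
  have hcov : covMat (fun ω => X ω - mulVecE K (Y ω)) Y μ = 0 := by
    rw [covMat_sub_left hX2 hKY hY2, covMat_mulVecE_left hY2 hY2, hK,
      Matrix.nonsing_inv_mul_cancel_right _ _ (isUnit_iff_ne_zero.2 hSY.det_pos.ne'), sub_self]
  have hG : HasGaussianLaw (fun ω => (X ω - mulVecE K (Y ω), Y ω)) μ :=
    hXY.map_fun ((ContinuousLinearMap.fst ℝ (E m) (E n) -
      (mulVecCLM K).comp (ContinuousLinearMap.snd ℝ (E m) (E n))).prod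
        (ContinuousLinearMap.snd ℝ (E m) (E n)))
  refine hG.indepFun_of_covariance_inner fun x y => ?_
  simp only [PiLp.inner_apply, RCLike.inner_apply, conj_trivial]
  rw [covariance_fun_sum_fun_sum (fun i => (memLp_coord hN2 i).mul_const _)
    (fun i => (memLp_coord hY2 i).mul_const _)]
  refine Finset.sum_eq_zero fun i _ => Finset.sum_eq_zero fun j _ => ?_
  have hij := congrFun (congrFun hcov i) j
  simp only [covMat, Matrix.of_apply, Matrix.zero_apply] at hij
  rw [covariance_mul_const_left, covariance_mul_const_right, hij]
  simp

lemma integral_residual (hXY : HasGaussianLaw (fun ω => (X ω, Y ω)) μ) (hX0 : μ[X] = 0)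
    (hY0 : μ[Y] = 0) (K : Matrix (Fin m) (Fin n) ℝ) : ∫ ω, (X ω - mulVecE K (Y ω)) ∂μ = 0 := by
  rw [integral_sub hXY.fst.integrable
      ((memLp_mulVecE hXY.snd.memLp_two K).integrable (by norm_num)),
    integral_mulVecE hXY.snd.integrable, hX0, hY0]
  exact (zero_sub _).trans (neg_eq_zero.2 (map_zero (mulVecCLM K)))

/-- In X = (X - KY) + KY the first summand is centred and independent of Y, so its conditional
expectation vanishes; the second is a function of Y. -/
lemma Xstar_ae_eq (hX : Measurable X) (hY : Measurable Y)
    (hXY : HasGaussianLaw (fun ω => (X ω, Y ω)) μ) (hX0 : μ[X] = 0) (hY0 : μ[Y] = 0)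
    (hSY : (covMat Y Y μ).PosDef) :
    Xstar X Y μ =ᵐ[μ] fun ω => mulVecE (covMat X Y μ * (covMat Y Y μ)⁻¹) (Y ω) := by
  set K := covMat X Y μ * (covMat Y Y μ)⁻¹ with hK
  have hle : MeasurableSpace.comap Y inferInstance ≤ ‹MeasurableSpace Ω› := hY.comap_le
  have hKYint : Integrable (fun ω => mulVecE K (Y ω)) μ :=
    (memLp_mulVecE hXY.snd.memLp_two K).integrable (by norm_num)
  have hNint : Integrable (fun ω => X ω - mulVecE K (Y ω)) μ := hXY.fst.integrable.sub hKYint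
  have hNm : Measurable fun ω => X ω - mulVecE K (Y ω) := by fun_prop
  have h1 : μ[fun ω => X ω - mulVecE K (Y ω) | MeasurableSpace.comap Y inferInstance] =ᵐ[μ]
      fun _ => ∫ ω, (X ω - mulVecE K (Y ω)) ∂μ :=
    condExp_indep_eq hNm.comap_le hle (comap_measurable _).stronglyMeasurable
      (indepFun_residual hXY hSY)
  have h2 : μ[fun ω => mulVecE K (Y ω) | MeasurableSpace.comap Y inferInstance] =
      fun ω => mulVecE K (Y ω) :=
    condExp_of_stronglyMeasurable hle
      (((measurable_mulVecE K).comp (comap_measurable Y)).stronglyMeasurable) hKYint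
  have h3 := condExp_add hNint hKYint (MeasurableSpace.comap Y inferInstance)
  have h4 : (fun ω => X ω - mulVecE K (Y ω)) + (fun ω => mulVecE K (Y ω)) = X := by
    ext1 ω; simp
  rw [h4, h2] at h3
  filter_upwards [h1, h3] with ω h1 h3
  rw [Xstar, h3, Pi.add_apply, h1, integral_residual hXY hX0 hY0, zero_add]

lemma covStar_eq (hX : Measurable X) (hY : Measurable Y)
    (hXY : HasGaussianLaw (fun ω => (X ω, Y ω)) μ) (hX0 : μ[X] = 0) (hY0 : μ[Y] = 0)
    (hSY : (covMat Y Y μ).PosDef) :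
    covStar X Y μ = covMat (fun ω => mulVecE (covMat X Y μ * (covMat Y Y μ)⁻¹) (Y ω))
      (fun ω => mulVecE (covMat X Y μ * (covMat Y Y μ)⁻¹) (Y ω)) μ :=
  have h := Xstar_ae_eq hX hY hXY hX0 hY0 hSY
  covMat_congr h h

end MMSE

/-! ### Mean squared error of an estimator -/

section KernelMSE

variable {Ω : Type*} [MeasurableSpace Ω] {m n : ℕ} {μ : Measure Ω}

lemma memLp_two_iff_lintegral_lt_top {U : Ω → E m} (hU : AEStronglyMeasurable U μ) :
    MemLp U 2 μ ↔ ∫⁻ ω, ‖U ω‖ₑ ^ 2 ∂μ < ∞ := by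
  have h := eLpNorm_lt_top_iff_lintegral_rpow_enorm_lt_top (f := U) (μ := μ) (p := 2)
    (by norm_num) (by norm_num)
  simp only [ENNReal.toReal_ofNat, ENNReal.rpow_ofNat] at h
  exact ⟨fun hm => h.1 hm.2, fun hl => ⟨hU, h.2 hl⟩⟩

/-- The Pythagorean theorem for square integrable and orthogonal random vectors; the second vector
need not be square integrable. -/
lemma lintegral_enorm_add_sq {A B : Ω → E m} (hA : MemLp A 2 μ) (hB : AEStronglyMeasurable B μ)
    (horth : MemLp B 2 μ → ∀ i, ∫ ω, A ω i * B ω i ∂μ = 0) :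
    ∫⁻ ω, ‖A ω + B ω‖ₑ ^ 2 ∂μ = ∫⁻ ω, ‖A ω‖ₑ ^ 2 ∂μ + ∫⁻ ω, ‖B ω‖ₑ ^ 2 ∂μ := by
  by_cases hB2 : MemLp B 2 μ
  · have hAB : MemLp (fun ω => A ω + B ω) 2 μ := hA.add hB2
    rw [lintegral_enorm_sq_eq_ofReal hA, lintegral_enorm_sq_eq_ofReal hB2,
      lintegral_enorm_sq_eq_ofReal hAB, ← ENNReal.ofReal_add (by positivity) (by positivity)]
    congr 1
    have hi : ∀ i, Integrable (fun ω => A ω i * B ω i) μ := fun i =>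
      (memLp_coord hA i).integrable_mul (memLp_coord hB2 i)
    have hin : ∫ ω, inner ℝ (A ω) (B ω) ∂μ = 0 := by
      simp only [PiLp.inner_apply, RCLike.inner_apply, conj_trivial]
      simp_rw [mul_comm (B _ _)]
      rw [integral_finsetSum _ fun i _ => hi i]
      exact Finset.sum_eq_zero fun i _ => horth hB2 i
    have hint : Integrable (fun ω => inner ℝ (A ω) (B ω)) μ := by
      simp only [PiLp.inner_apply, RCLike.inner_apply, conj_trivial]
      simp_rw [mul_comm (B _ _)]
      exact integrable_finsetSum _ fun i _ => hi i
    have hA1 : Integrable (fun ω => ‖A ω‖ ^ 2) μ := hA.integrable_norm_pow (by norm_num)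
    have hAB1 : Integrable (fun ω => ‖A ω‖ ^ 2 + 2 * inner ℝ (A ω) (B ω)) μ :=
      hA1.add (hint.const_mul 2)
    simp_rw [norm_add_sq_real]
    rw [integral_add hAB1 (hB2.integrable_norm_pow (by norm_num)),
      integral_add hA1 (hint.const_mul 2), integral_const_mul, hin]
    ring
  -- Without square integrability of B both sides are infinite, since A + B in L² would force B in
  -- L².
  · have h1 : ∫⁻ ω, ‖B ω‖ₑ ^ 2 ∂μ = ∞ := by
      by_contra h
      exact hB2 ((memLp_two_iff_lintegral_lt_top hB).2 (lt_top_iff_ne_top.2 h))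
    rw [h1, add_top]
    by_contra h
    have hAB : MemLp (fun ω => A ω + B ω) 2 μ :=
      (memLp_two_iff_lintegral_lt_top (hA.aestronglyMeasurable.add hB)).2 (lt_top_iff_ne_top.2 h)
    have hBeq : (fun ω => A ω + B ω) - A = B := by
      ext1 ω
      simp
    exact hB2 (hBeq ▸ hAB.sub hA)

variable [IsProbabilityMeasure μ] {X : Ω → E m} {Y : Ω → E n} {g : E n → E m}

/-- If `X - g(Y)` is centred and independent of `Y`, the mean squared error of an estimator splits
into that of `g(Y)` and the mean squared distance of the estimate from `g(Y)`. -/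
lemma kernelMSE_eq_add (hX : Measurable X) (hY : Measurable Y) (hg : Measurable g)
    (hN : MemLp (fun ω => X ω - g (Y ω)) 2 μ) (hN0 : ∫ ω, (X ω - g (Y ω)) ∂μ = 0)
    (hind : IndepFun (fun ω => X ω - g (Y ω)) Y μ) (κ : Kernel (E n) (E m)) [IsMarkovKernel κ] :
    kernelMSE κ X Y μ = ∫⁻ ω, ‖X ω - g (Y ω)‖ₑ ^ 2 ∂μ
      + ∫⁻ ω, ∫⁻ z, ‖g (Y ω) - z‖ₑ ^ 2 ∂(κ (Y ω)) ∂μ := by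
  set η : Kernel Ω (E m) := κ.comap Y hY with hη
  have hA : MemLp (fun p : Ω × E m => X p.1 - g (Y p.1)) 2 (μ ⊗ₘ η) := by
    refine (memLp_map_measure_iff (μ := μ ⊗ₘ η) (f := Prod.fst) (g := fun ω => X ω - g (Y ω))
      ?_ measurable_fst.aemeasurable).1 ?_
    · exact Measurable.aestronglyMeasurable (by fun_prop)
    · have : (μ ⊗ₘ η).map Prod.fst = μ := Measure.fst_compProd _ _
      rwa [this]
  have hB : AEStronglyMeasurable (fun p : Ω × E m => g (Y p.1) - p.2) (μ ⊗ₘ η) :=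
    Measurable.aestronglyMeasurable (by fun_prop)
  have h := lintegral_enorm_add_sq hA hB fun hB2 i => by
    have hint : Integrable (fun p : Ω × E m => (X p.1 - g (Y p.1)) i * (g (Y p.1) - p.2) i)
        (μ ⊗ₘ η) := (memLp_coord hA i).integrable_mul (memLp_coord hB2 i)
    rw [Measure.integral_compProd hint]
    simp_rw [integral_const_mul]
    -- Integrating out the estimate leaves a function of Y, which is independent of the centred
    -- residual; the cross term therefore factors through a zero mean.
    have hsm : StronglyMeasurable fun y : E n => ∫ z, (g y - z) i ∂κ y :=
      StronglyMeasurable.integral_kernel_prod_right' (κ := κ)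
        (f := fun p : E n × E m => (g p.1 - p.2) i) (Measurable.stronglyMeasurable (by fun_prop))
    have hi : IndepFun (fun ω => (X ω - g (Y ω)) i) (fun ω => ∫ z, (g (Y ω) - z) i ∂κ (Y ω)) μ :=
      hind.comp (φ := fun x : E m => x i) (by fun_prop) hsm.measurable
    refine (hi.integral_fun_mul_eq_mul_integral (memLp_coord hN i).aestronglyMeasurable
      (hsm.measurable.comp hY).aestronglyMeasurable).trans ?_
    rw [integral_coord (hN.integrable (by norm_num)), hN0]
    simp
  simp only [sub_add_sub_cancel] at h
  rw [Measure.lintegral_compProd (by fun_prop), Measure.lintegral_compProd (by fun_prop),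
    Measure.lintegral_compProd (by fun_prop)] at h
  simpa [kernelMSE, hη] using h

/-- The law of the estimate is at most as far from that of `g(Y)` as the estimate from `g(Y)`. -/
lemma W2_map_outputLaw_le (hY : Measurable Y) (hg : Measurable g) (κ : Kernel (E n) (E m))
    [IsMarkovKernel κ] :
    W2 (μ.map fun ω => g (Y ω)) (outputLaw κ Y μ) ≤
      (∫⁻ ω, ∫⁻ z, ‖g (Y ω) - z‖ₑ ^ 2 ∂(κ (Y ω)) ∂μ) ^ (1 / 2 : ℝ) := by
  set η : Kernel Ω (E m) := κ.comap Y hY with hη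
  have h1 : (μ ⊗ₘ η).map (fun p => g (Y p.1)) = μ.map fun ω => g (Y ω) := by
    have : (μ ⊗ₘ η).map Prod.fst = μ := Measure.fst_compProd _ _
    conv_rhs => rw [← this, Measure.map_map (by fun_prop) measurable_fst]
    rfl
  have h2 : (μ ⊗ₘ η).map (fun p => p.2) = outputLaw κ Y μ := by
    have : (μ ⊗ₘ η).map (fun p => p.2) = μ.bind η := Measure.snd_compProd _ _
    rw [this, outputLaw]
    ext s hs
    rw [Measure.bind_apply hs η.aemeasurable, Measure.bind_apply hs κ.aemeasurable,
      lintegral_map (κ.measurable_coe hs) hY]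
    rfl
  rw [← h1, ← h2]
  refine (W2_map_le (by fun_prop) (by fun_prop)).trans_eq ?_
  rw [Measure.lintegral_compProd (by fun_prop)]
  rfl

end KernelMSE

/-! ### Random vectors realising an estimator -/

section GeneratedBy

variable {Ω : Type*} [MeasurableSpace Ω] {m n : ℕ} {μ : Measure Ω} [IsProbabilityMeasure μ]
  {X : Ω → E m} {Y : Ω → E n} {κ : Kernel (E n) (E m)} [IsMarkovKernel κ] {Xhat : Ω → E m}

lemma IsGeneratedBy.map_eq_outputLaw (hX : Measurable X) (hY : Measurable Y)
    (hXhat : AEMeasurable Xhat μ) (h : IsGeneratedBy Xhat κ X Y μ) :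
    μ.map Xhat = outputLaw κ Y μ := by
  have h1 := congrArg (Measure.map Prod.snd) h
  rw [AEMeasurable.map_map_of_aemeasurable measurable_snd.aemeasurable
    ((hX.prodMk hY).aemeasurable.prodMk hXhat)] at h1
  have h2 : Measure.map Prod.snd ((μ.map fun ω => (X ω, Y ω)).compProd
      (Kernel.prodMkLeft (E m) κ)) = outputLaw κ Y μ := by
    refine (Measure.snd_compProd _ _).trans ?_
    ext s hs
    rw [outputLaw, Measure.bind_apply hs (Kernel.aemeasurable _),
      Measure.bind_apply hs κ.aemeasurable, lintegral_map (κ.measurable_coe hs) hY,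
      lintegral_map (Kernel.measurable_coe _ hs) (hX.prodMk hY)]
    rfl
  rw [h2] at h1
  exact h1

lemma IsGeneratedBy.lintegral_eq_kernelMSE (hX : Measurable X) (hY : Measurable Y)
    (hXhat : AEMeasurable Xhat μ) (h : IsGeneratedBy Xhat κ X Y μ) :
    ∫⁻ ω, ‖X ω - Xhat ω‖ₑ ^ 2 ∂μ = kernelMSE κ X Y μ := by
  have hm : Measurable fun p : (E m × E n) × E m => ‖p.1.1 - p.2‖ₑ ^ 2 := by fun_prop
  have h1 := congrArg (fun ν => ∫⁻ p, ‖p.1.1 - p.2‖ₑ ^ 2 ∂ν) h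
  rw [lintegral_map' hm.aemeasurable ((hX.prodMk hY).aemeasurable.prodMk hXhat),
    Measure.lintegral_compProd hm, lintegral_map (by fun_prop) (hX.prodMk hY)] at h1
  exact h1

end GeneratedBy

/-! ### The estimator -/

section Estimator

variable {Ω : Type*} [MeasurableSpace Ω] {m n : ℕ} {μ : Measure Ω}
  {X : Ω → E m} {Y : Ω → E n}

/-- The regression matrix `Σ_XY Σ_Y⁻¹`. -/
noncomputable def regression (X : Ω → E m) (Y : Ω → E n) (μ : Measure Ω) :
    Matrix (Fin m) (Fin n) ℝ :=
  covMat X Y μ * (covMat Y Y μ)⁻¹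

/-- The matrix which maps `X*` to the linear part of the estimate at perception index zero. -/
noncomputable def liftMat (X : Ω → E m) (Y : Ω → E n) (μ : Measure Ω) :
    Matrix (Fin m) (Fin m) ℝ :=
  covMat X X μ * transport (covMat X X μ) (covStar X Y μ) * pinv (covStar X Y μ)

/-- The estimate at perception index zero, as a function of `y = Y` and the noise `w = W`. -/
noncomputable def perfectEstimate (X : Ω → E m) (Y : Ω → E n) (μ : Measure Ω) (z : E n × E m) :
    E m :=
  mulVecE (liftMat X Y μ * regression X Y μ) z.1 + z.2

/-- Because of this segment form, the distances of the estimate from both endpoints are multiples of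
a single one. -/
lemma estimate_eq (hSX : (covMat X X μ).PosDef) (P : ℝ) (y : E n) (w : E m) :
    estimate X Y μ P y w = (1 - P / Gstar X Y μ) • perfectEstimate X Y μ (y, w)
      + (P / Gstar X Y μ) • mulVecE (regression X Y μ) y := by
  simp only [estimate, gain, perfectEstimate, liftMat]
  rw [mul_transport hSX, Matrix.mul_assoc _ (covMat X Y μ), ← regression, Matrix.add_mul,
    Matrix.smul_mul, Matrix.smul_mul, Matrix.one_mul, mulVecE_add_left, mulVecE_smul_left,
    mulVecE_smul_left, smul_add]
  abel

@[fun_prop]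
lemma measurable_perfectEstimate (X : Ω → E m) (Y : Ω → E n) (μ : Measure Ω) :
    Measurable (perfectEstimate X Y μ) := by
  unfold perfectEstimate
  fun_prop

@[fun_prop]
lemma measurable_estimate (X : Ω → E m) (Y : Ω → E n) (μ : Measure Ω) (P : ℝ) :
    Measurable fun z : E n × E m => estimate X Y μ P z.1 z.2 := by
  unfold estimate
  fun_prop

lemma aemeasurable_estimate (hY : AEMeasurable Y μ) {W : Ω → E m} (hW : AEMeasurable W μ) (P : ℝ) :
    AEMeasurable (fun ω => estimate X Y μ P (Y ω) (W ω)) μ := by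
  unfold estimate
  exact ((measurable_mulVecE _).comp_aemeasurable hY).add (hW.fun_const_smul _)

instance isMarkovKernel_estimatorKernel (X : Ω → E m) (Y : Ω → E n) (μ : Measure Ω) (P : ℝ) :
    IsMarkovKernel (estimatorKernel X Y μ P) :=
  Kernel.IsMarkovKernel.map _ (measurable_estimate X Y μ P)

lemma lintegral_estimatorKernel (X : Ω → E m) (Y : Ω → E n) (μ : Measure Ω) (P : ℝ) (y : E n)
    {f : E m → ℝ≥0∞} (hf : Measurable f) :
    ∫⁻ z, f z ∂(estimatorKernel X Y μ P y) =
      ∫⁻ w, f (estimate X Y μ P y w) ∂(multivariateGaussian 0 (covW X Y μ)) := by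
  have he := measurable_estimate X Y μ P
  rw [estimatorKernel, Kernel.map_apply _ he, lintegral_map hf he, Kernel.prod_apply,
    Kernel.id_apply, Kernel.const_apply, lintegral_prod _ (by fun_prop), lintegral_dirac' _
      (Measurable.lintegral_prod_right' (f := fun z : E n × E m => f (estimate X Y μ P z.1 z.2))
        (by fun_prop))]

lemma estimatorKernel_apply (X : Ω → E m) (Y : Ω → E n) (μ : Measure Ω) (P : ℝ) (y : E n)
    {s : Set (E m)} (hs : MeasurableSet s) :
    estimatorKernel X Y μ P y s =
      multivariateGaussian 0 (covW X Y μ) (estimate X Y μ P y ⁻¹' s) := by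
  have he : Measurable (estimate X Y μ P y) :=
    (measurable_estimate X Y μ P).comp measurable_prodMk_left
  rw [← lintegral_indicator_one hs,
    lintegral_estimatorKernel _ _ _ _ _ (measurable_one.indicator hs),
    ← lintegral_indicator_one (he hs)]
  rfl

/-- If G* = 0, then P = 0 as well, and division by zero returning 0 keeps the identity true. -/
lemma div_Gstar_mul {P : ℝ} (hP : P ∈ Set.Icc 0 (Gstar X Y μ)) :
    P / Gstar X Y μ * Gstar X Y μ = P := by
  rcases eq_or_ne (Gstar X Y μ) 0 with hG | hG
  · rw [hG] at hP ⊢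
    simpa using le_antisymm hP.1 hP.2
  · exact div_mul_cancel₀ P hG

lemma div_Gstar_mem {P : ℝ} (hP : P ∈ Set.Icc 0 (Gstar X Y μ)) :
    0 ≤ P / Gstar X Y μ ∧ P / Gstar X Y μ ≤ 1 :=
  ⟨div_nonneg hP.1 (hP.1.trans hP.2), div_le_one_of_le₀ hP.2 (hP.1.trans hP.2)⟩

lemma lintegral_enorm_smul_sq {Ω' : Type*} [MeasurableSpace Ω'] (ν : Measure Ω') {c : ℝ}
    (hc : 0 ≤ c) {U : Ω' → E m} (hU : Measurable U) :
    ∫⁻ ω, ‖c • U ω‖ₑ ^ 2 ∂ν = ENNReal.ofReal c ^ 2 * ∫⁻ ω, ‖U ω‖ₑ ^ 2 ∂ν := by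
  rw [← lintegral_const_mul _ (by fun_prop)]
  refine lintegral_congr fun ω => ?_
  rw [enorm_smul, mul_pow, Real.enorm_of_nonneg hc]

variable [IsProbabilityMeasure μ]

/-- The joint law of `Y` and an independent noise with covariance `Σ_W`. -/
noncomputable def noisyLaw (X : Ω → E m) (Y : Ω → E n) (μ : Measure Ω) : Measure (E n × E m) :=
  (μ.map Y).prod (multivariateGaussian 0 (covW X Y μ))

/-- The kernel is analysed on a product space, so `Ω` itself need not carry any noise. -/
lemma outputLaw_estimatorKernel (hY : Measurable Y) (P : ℝ) :
    outputLaw (estimatorKernel X Y μ P) Y μ =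
      (noisyLaw X Y μ).map fun z => estimate X Y μ P z.1 z.2 := by
  have he := measurable_estimate X Y μ P
  have := Measure.isProbabilityMeasure_map (μ := μ) hY.aemeasurable
  ext s hs
  rw [outputLaw, Measure.bind_apply hs (Kernel.aemeasurable _), Measure.map_apply he hs, noisyLaw,
    Measure.prod_apply (he hs)]
  exact lintegral_congr fun y => estimatorKernel_apply X Y μ P y hs

lemma lintegral_lintegral_estimatorKernel (hY : Measurable Y) (P : ℝ) {g : E n → E m}
    (hg : Measurable g) :
    ∫⁻ ω, ∫⁻ z, ‖g (Y ω) - z‖ₑ ^ 2 ∂(estimatorKernel X Y μ P (Y ω)) ∂μ =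
      ∫⁻ z, ‖g z.1 - estimate X Y μ P z.1 z.2‖ₑ ^ 2 ∂(noisyLaw X Y μ) := by
  have he := measurable_estimate X Y μ P
  have := Measure.isProbabilityMeasure_map (μ := μ) hY.aemeasurable
  have hm : Measurable fun z : E n × E m => ‖g z.1 - estimate X Y μ P z.1 z.2‖ₑ ^ 2 := by fun_prop
  rw [noisyLaw, lintegral_prod _ hm.aemeasurable, lintegral_map hm.lintegral_prod_right' hY]
  exact lintegral_congr fun ω => lintegral_estimatorKernel X Y μ P (Y ω) (by fun_prop)

/-- `X` and `Y` are measurable, centred and jointly Gaussian with nonsingular covariances. -/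
structure IsGaussianModel (X : Ω → E m) (Y : Ω → E n) (μ : Measure Ω) : Prop where
  measurable_fst : Measurable X
  measurable_snd : Measurable Y
  gaussian : HasGaussianLaw (fun ω => (X ω, Y ω)) μ
  mean_fst : μ[X] = 0
  mean_snd : μ[Y] = 0
  posDef_fst : (covMat X X μ).PosDef
  posDef_snd : (covMat Y Y μ).PosDef

/-! ### Optimality in the Gaussian model -/

section Gaussian

lemma covStar_eq_covMat (h : IsGaussianModel X Y μ) :
    covStar X Y μ = covMat (fun ω => mulVecE (regression X Y μ) (Y ω))
      (fun ω => mulVecE (regression X Y μ) (Y ω)) μ :=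
  covStar_eq h.1 h.2 h.3 h.4 h.5 h.7

/-- The covariance of a linear image of `X*`. -/
lemma mul_regression_cov (h : IsGaussianModel X Y μ) (A : Matrix (Fin m) (Fin m) ℝ) :
    (A * regression X Y μ) * covMat Y Y μ * (A * regression X Y μ)ᵀ = A * covStar X Y μ * Aᵀ := by
  rw [covStar_eq_covMat h, covMat_mulVecE h.gaussian.snd.memLp_two, Matrix.transpose_mul]
  simp only [Matrix.mul_assoc]

lemma posSemidef_covStar (h : IsGaussianModel X Y μ) : (covStar X Y μ).PosSemidef := by
  rw [covStar_eq_covMat h]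
  exact posSemidef_covMat (memLp_mulVecE h.gaussian.snd.memLp_two _)

lemma ofReal_Gstar_le_W2 (h : IsGaussianModel X Y μ) :
    ENNReal.ofReal (Gstar X Y μ) ≤
      W2 (μ.map X) (μ.map fun ω => mulVecE (regression X Y μ) (Y ω)) := by
  have hY2 := h.gaussian.snd.memLp_two
  have hc := covStar_eq_covMat h
  have hg := gelbrich_le_W2 h.gaussian.fst.memLp_two (memLp_mulVecE hY2 (regression X Y μ))
    h.mean_fst
    (by rw [integral_mulVecE h.gaussian.snd.integrable, h.mean_snd]; exact map_zero (mulVecCLM _))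
    h.posDef_fst
    (posSemidef_covMat (memLp_mulVecE hY2 _))
  rw [Gstar, hc]
  exact hg

lemma posSemidef_covW (h : IsGaussianModel X Y μ) : (covW X Y μ).PosSemidef :=
  posSemidef_noiseCov h.posDef_fst (posSemidef_covStar h)

/-- An affine image `A Y + W` under the joint law of `Y` and the noise: law and moments. -/
lemma noisyLaw_linear (h : IsGaussianModel X Y μ) (A : Matrix (Fin m) (Fin n) ℝ) :
    HasGaussianLaw (fun z : E n × E m => mulVecE A z.1 + z.2) (noisyLaw X Y μ) ∧
    ∫ z, (mulVecE A z.1 + z.2) ∂(noisyLaw X Y μ) = 0 ∧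
    covMat (fun z => mulVecE A z.1 + z.2) (fun z => mulVecE A z.1 + z.2) (noisyLaw X Y μ) =
      A * covMat Y Y μ * Aᵀ + covW X Y μ := by
  have hW := posSemidef_covW h
  have hp := Measure.isProbabilityMeasure_map (μ := μ) h.measurable_snd.aemeasurable
  have hpn : IsProbabilityMeasure (noisyLaw X Y μ) := by unfold noisyLaw; infer_instance
  have hm1 : (noisyLaw X Y μ).map Prod.fst = μ.map Y := by
    rw [noisyLaw, Measure.map_fst_prod]; simp
  have hm2 : (noisyLaw X Y μ).map Prod.snd = multivariateGaussian 0 (covW X Y μ) := by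
    rw [noisyLaw, Measure.map_snd_prod]; simp
  have hG1 : HasGaussianLaw (Prod.fst : E n × E m → E n) (noisyLaw X Y μ) :=
    ⟨by rw [hm1]; exact h.gaussian.snd.isGaussian_map⟩
  have hG2 : HasGaussianLaw (Prod.snd : E n × E m → E m) (noisyLaw X Y μ) :=
    ⟨by rw [hm2]; infer_instance⟩
  have hind : IndepFun (Prod.fst : E n × E m → E n) Prod.snd (noisyLaw X Y μ) :=
    indepFun_prod (X := id) (Y := id) measurable_id measurable_id
  have hindA : IndepFun (fun z : E n × E m => mulVecE A z.1) Prod.snd (noisyLaw X Y μ) :=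
    hind.comp (measurable_mulVecE A) measurable_id
  have hGA : HasGaussianLaw (fun z : E n × E m => mulVecE A z.1) (noisyLaw X Y μ) :=
    hG1.map_fun (mulVecCLM A)
  refine ⟨(hindA.hasGaussianLaw hGA hG2).fun_add, ?_, ?_⟩
  · have h1 : ∫ z, z.1 ∂(noisyLaw X Y μ) = 0 := by
      rw [← integral_map (φ := Prod.fst) (f := fun x : E n => x) (by fun_prop) (by fun_prop), hm1,
        integral_map h.measurable_snd.aemeasurable (by fun_prop), h.mean_snd]
    have h2 : ∫ z, z.2 ∂(noisyLaw X Y μ) = 0 := by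
      rw [← integral_map (φ := Prod.snd) (f := fun x : E m => x) (by fun_prop) (by fun_prop), hm2,
        integral_id_multivariateGaussian]
    rw [integral_add hGA.integrable hG2.integrable, integral_mulVecE hG1.integrable, h1, h2,
      add_zero]
    exact map_zero (mulVecCLM A)
  · rw [covMat_add_of_indepFun hGA.memLp_two hG2.memLp_two hindA, covMat_mulVecE hG1.memLp_two]
    have h1 : covMat (Prod.fst : E n × E m → E n) Prod.fst (noisyLaw X Y μ) = covMat Y Y μ := by
      have hmap := covMat_map (ν := noisyLaw X Y μ) (Z := (Prod.fst : E n × E m → E n))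
        (by fun_prop) measurable_id measurable_id
      rw [hm1, covMat_map h.measurable_snd.aemeasurable measurable_id measurable_id] at hmap
      exact hmap.symm
    have h2 : covMat (Prod.snd : E n × E m → E m) Prod.snd (noisyLaw X Y μ) = covW X Y μ := by
      have hmap := covMat_map (ν := noisyLaw X Y μ) (Z := (Prod.snd : E n × E m → E m))
        (by fun_prop) measurable_id measurable_id
      rw [hm2] at hmap
      refine hmap.symm.trans ?_
      ext i j
      exact covariance_eval_multivariateGaussian hW i j
    rw [h1, h2]

/-- At perception index zero the estimate has the law of `X`. -/
lemma map_perfectEstimate (h : IsGaussianModel X Y μ) :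
    (noisyLaw X Y μ).map (perfectEstimate X Y μ) = μ.map X := by
  have hS' := posSemidef_covStar h
  obtain ⟨hG, h0, hc⟩ := noisyLaw_linear h
    (liftMat X Y μ * regression X Y μ)
  have hpn := hG.isProbabilityMeasure
  rw [map_eq_multivariateGaussian h.gaussian.fst h.mean_fst h.posDef_fst.posSemidef rfl]
  refine map_eq_multivariateGaussian hG h0 h.posDef_fst.posSemidef (hc.trans ?_)
  rw [← gain_cov_add_noiseCov h.posDef_fst hS', covW]
  rw [mul_regression_cov h, liftMat]

/-- The mean squared distance of `X*` and the estimate at perception index zero. -/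
lemma lintegral_perfectEstimate_sub (h : IsGaussianModel X Y μ) :
    ∫⁻ z, ‖perfectEstimate X Y μ z - mulVecE (regression X Y μ) z.1‖ₑ ^ 2 ∂(noisyLaw X Y μ) =
      ENNReal.ofReal (Gstar X Y μ) ^ 2 := by
  have hS' := posSemidef_covStar h
  obtain ⟨hG, h0, hc⟩ := noisyLaw_linear h
    ((liftMat X Y μ - 1) * regression X Y μ)
  have hpn := hG.isProbabilityMeasure
  have heq : ∀ z : E n × E m, perfectEstimate X Y μ z - mulVecE (regression X Y μ) z.1 =
      mulVecE ((liftMat X Y μ - 1) * regression X Y μ) z.1 + z.2 := by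
    intro z
    rw [perfectEstimate, Matrix.sub_mul, Matrix.one_mul, mulVecE_sub_left]
    abel
  simp_rw [heq]
  rw [lintegral_enorm_sq_eq_trace hG.memLp_two h0, hc, Gstar, ofReal_gelbrich_sq,
    ← trace_gap h.posDef_fst hS', mul_regression_cov h, liftMat, covW]

/-- The mean squared distance of the estimate from `X*`. -/
lemma lintegral_regression_sub_estimate (h : IsGaussianModel X Y μ) {P : ℝ}
    (hP : P ∈ Set.Icc 0 (Gstar X Y μ)) :
    ∫⁻ z, ‖mulVecE (regression X Y μ) z.1 - estimate X Y μ P z.1 z.2‖ₑ ^ 2 ∂(noisyLaw X Y μ) =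
      ENNReal.ofReal (Gstar X Y μ - P) ^ 2 := by
  have ht := div_Gstar_mem hP
  have heq : ∀ z : E n × E m, ‖mulVecE (regression X Y μ) z.1 - estimate X Y μ P z.1 z.2‖ₑ =
      ‖(1 - P / Gstar X Y μ) • (perfectEstimate X Y μ z - mulVecE (regression X Y μ) z.1)‖ₑ := by
    intro z
    rw [estimate_eq h.posDef_fst, enorm_sub_rev]
    congr 1
    module
  simp_rw [heq]
  rw [lintegral_enorm_smul_sq _ (by linarith) (by fun_prop), lintegral_perfectEstimate_sub h,
    ← mul_pow, ← ENNReal.ofReal_mul (by linarith), sub_mul, one_mul, div_Gstar_mul hP]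

/-- X̂_0 has the law of X, so driving X̂_0 and X̂_P by the same Y and noise gives a coupling, of
cost (P / G*)² G*² = P². -/
lemma W2_outputLaw_le (h : IsGaussianModel X Y μ) {P : ℝ} (hP : P ∈ Set.Icc 0 (Gstar X Y μ)) :
    W2 (μ.map X) (outputLaw (estimatorKernel X Y μ P) Y μ) ≤ ENNReal.ofReal P := by
  have ht := div_Gstar_mem hP
  have heq : ∀ z : E n × E m, perfectEstimate X Y μ z - estimate X Y μ P z.1 z.2 =
      (P / Gstar X Y μ) • (perfectEstimate X Y μ z - mulVecE (regression X Y μ) z.1) := by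
    intro z
    rw [estimate_eq h.posDef_fst]
    module
  rw [outputLaw_estimatorKernel h.measurable_snd, ← map_perfectEstimate h]
  refine (W2_map_le (by fun_prop) (by fun_prop)).trans_eq ?_
  simp_rw [heq]
  rw [lintegral_enorm_smul_sq _ ht.1 (by fun_prop), lintegral_perfectEstimate_sub h,
    ← mul_pow, ← ENNReal.ofReal_mul ht.1, div_Gstar_mul hP, rpow_half_sq]

/-- An estimator with perception index at most `P` is at distance at least `G* - P` from `X*`. -/
lemma ofReal_Gstar_sub_le (h : IsGaussianModel X Y μ) {P : ℝ} (hP : P ∈ Set.Icc 0 (Gstar X Y μ))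
    (κ : Kernel (E n) (E m)) [IsMarkovKernel κ]
    (hκ : W2 (μ.map X) (outputLaw κ Y μ) ≤ ENNReal.ofReal P) :
    ENNReal.ofReal (Gstar X Y μ - P) ^ 2 ≤
      ∫⁻ ω, ∫⁻ z, ‖mulVecE (regression X Y μ) (Y ω) - z‖ₑ ^ 2 ∂(κ (Y ω)) ∂μ := by
  have := Measure.isProbabilityMeasure_map (μ := μ) h.measurable_snd.aemeasurable
  have : IsProbabilityMeasure (outputLaw κ Y μ) := by unfold outputLaw; infer_instance
  have h1 := (ofReal_Gstar_le_W2 h).trans (W2_triangle _ (outputLaw κ Y μ) _)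
  rw [W2_comm (outputLaw κ Y μ)] at h1
  have h2 := W2_map_outputLaw_le (μ := μ) h.measurable_snd (measurable_mulVecE (regression X Y μ)) κ
  rw [← rpow_sq_half (∫⁻ ω, _ ∂μ)]
  refine pow_le_pow_left' ?_ 2
  rw [ENNReal.ofReal_sub _ hP.1]
  exact tsub_le_iff_left.2 (h1.trans (add_le_add hκ h2))

/-- For the lower bound, G* ≤ W2(X, X̂_P) + W2(X̂_P, X*) and the last term is at most G* - P, which
is finite and cancels. -/
lemma W2_outputLaw_eq (h : IsGaussianModel X Y μ) {P : ℝ} (hP : P ∈ Set.Icc 0 (Gstar X Y μ)) :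
    W2 (μ.map X) (outputLaw (estimatorKernel X Y μ P) Y μ) = ENNReal.ofReal P := by
  refine le_antisymm (W2_outputLaw_le h hP) ?_
  have := Measure.isProbabilityMeasure_map (μ := μ) h.measurable_snd.aemeasurable
  have : IsProbabilityMeasure (outputLaw (estimatorKernel X Y μ P) Y μ) := by
    unfold outputLaw; infer_instance
  have h1 := (ofReal_Gstar_le_W2 h).trans
    (W2_triangle _ (outputLaw (estimatorKernel X Y μ P) Y μ) _)
  have h2 := W2_map_outputLaw_le (μ := μ) h.measurable_snd (measurable_mulVecE (regression X Y μ))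
    (estimatorKernel X Y μ P)
  rw [lintegral_lintegral_estimatorKernel h.measurable_snd P (measurable_mulVecE _),
    lintegral_regression_sub_estimate h hP, rpow_half_sq, W2_comm] at h2
  have h3 := h1.trans (add_le_add le_rfl h2)
  have hsplit : ENNReal.ofReal (Gstar X Y μ) =
      ENNReal.ofReal P + ENNReal.ofReal (Gstar X Y μ - P) := by
    rw [← ENNReal.ofReal_add hP.1 (sub_nonneg.2 hP.2)]
    congr 1
    ring
  rw [hsplit] at h3
  exact (ENNReal.add_le_add_iff_right ENNReal.ofReal_ne_top).1 h3

lemma kernelMSE_eq_of_isGaussianModel (h : IsGaussianModel X Y μ) (κ : Kernel (E n) (E m))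
    [IsMarkovKernel κ] :
    kernelMSE κ X Y μ = ∫⁻ ω, ‖X ω - mulVecE (regression X Y μ) (Y ω)‖ₑ ^ 2 ∂μ
      + ∫⁻ ω, ∫⁻ z, ‖mulVecE (regression X Y μ) (Y ω) - z‖ₑ ^ 2 ∂(κ (Y ω)) ∂μ :=
  kernelMSE_eq_add h.measurable_fst h.measurable_snd (measurable_mulVecE _)
    (h.gaussian.fst.memLp_two.sub (memLp_mulVecE h.gaussian.snd.memLp_two _))
    (integral_residual h.gaussian h.mean_fst h.mean_snd _)
    (indepFun_residual h.gaussian h.posDef_snd) κ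

/-- The term E‖X - X*‖² is common to all estimators, so only the distances from X* are compared. -/
lemma kernelMSE_eq_DP (h : IsGaussianModel X Y μ) {P : ℝ} (hP : P ∈ Set.Icc 0 (Gstar X Y μ)) :
    kernelMSE (estimatorKernel X Y μ P) X Y μ = DP X Y μ P := by
  refine le_antisymm (le_iInf fun κ => le_iInf fun hκ => le_iInf fun hW => ?_)
    (iInf_le_of_le _ (iInf₂_le (isMarkovKernel_estimatorKernel X Y μ P)
      (W2_outputLaw_le h hP)))
  rw [kernelMSE_eq_of_isGaussianModel h, kernelMSE_eq_of_isGaussianModel h,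
    lintegral_lintegral_estimatorKernel h.measurable_snd P (measurable_mulVecE _),
    lintegral_regression_sub_estimate h hP]
  gcongr
  exact ofReal_Gstar_sub_le h hP κ hW

/-- Independence of W from the pair (X, Y) makes the joint law a product; conditioning on (X, Y)
then leaves W untouched, and X does not enter the estimate. -/
lemma isGeneratedBy_estimate (h : IsGaussianModel X Y μ) (P : ℝ) {W : Ω → E m}
    (hW : IsNoise W X Y μ) :
    IsGeneratedBy (fun ω => estimate X Y μ P (Y ω) (W ω)) (estimatorKernel X Y μ P) X Y μ := by
  have hXYm : Measurable fun ω => (X ω, Y ω) := h.measurable_fst.prodMk h.measurable_snd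
  have hWm := hW.gaussian.aemeasurable
  have hp := Measure.isProbabilityMeasure_map (μ := μ) hXYm.aemeasurable
  have he := measurable_estimate X Y μ P
  have hlaw : μ.map (fun ω => ((X ω, Y ω), W ω)) =
      (μ.map fun ω => (X ω, Y ω)).prod (multivariateGaussian 0 (covW X Y μ)) := by
    rw [(indepFun_iff_map_prod_eq_prod_map_map hXYm.aemeasurable hWm).1 hW.indep.symm,
      map_eq_multivariateGaussian hW.gaussian hW.mean_zero (posSemidef_covW h) hW.cov_eq]
  have hf : Measurable fun p : (E m × E n) × E m => (p.1, estimate X Y μ P p.1.2 p.2) :=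
    measurable_fst.prodMk (he.comp (by fun_prop : Measurable fun p : (E m × E n) × E m =>
      (p.1.2, p.2)))
  have hmap : μ.map (fun ω => ((X ω, Y ω), estimate X Y μ P (Y ω) (W ω))) =
      ((μ.map fun ω => (X ω, Y ω)).prod (multivariateGaussian 0 (covW X Y μ))).map
        fun p : (E m × E n) × E m => (p.1, estimate X Y μ P p.1.2 p.2) := by
    rw [← hlaw, AEMeasurable.map_map_of_aemeasurable hf.aemeasurable
      (hXYm.aemeasurable.prodMk hWm)]
    rfl
  rw [IsGeneratedBy, hmap]
  ext s hs
  rw [Measure.map_apply hf hs, Measure.prod_apply (hf hs), Measure.compProd_apply hs]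
  refine lintegral_congr fun p => ?_
  rw [Kernel.prodMkLeft_apply, estimatorKernel_apply _ _ _ _ _ (measurable_prodMk_left hs)]
  rfl

/-- The estimate built from a given noise vector attains the distortion-perception function. -/
lemma estimate_optimal (h : IsGaussianModel X Y μ) {P : ℝ}
    (hP : P ∈ Set.Icc 0 (Gstar X Y μ)) {W : Ω → E m} (hW : IsNoise W X Y μ) :
    IsGeneratedBy (fun ω => estimate X Y μ P (Y ω) (W ω)) (estimatorKernel X Y μ P) X Y μ ∧
    W2 (μ.map X) (μ.map (fun ω => estimate X Y μ P (Y ω) (W ω))) = ENNReal.ofReal P ∧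
    ∫⁻ ω, ‖X ω - estimate X Y μ P (Y ω) (W ω)‖ₑ ^ 2 ∂μ = DP X Y μ P := by
  have hgen := isGeneratedBy_estimate h P hW
  have hm : AEMeasurable (fun ω => estimate X Y μ P (Y ω) (W ω)) μ :=
    aemeasurable_estimate h.measurable_snd.aemeasurable hW.gaussian.aemeasurable P
  refine ⟨hgen, ?_, ?_⟩
  · rw [hgen.map_eq_outputLaw h.measurable_fst h.measurable_snd hm]
    exact W2_outputLaw_eq h hP
  · rw [hgen.lintegral_eq_kernelMSE h.measurable_fst h.measurable_snd hm]
    exact kernelMSE_eq_DP h hP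

end Gaussian

end Estimator

end DistortionPerception

theorem theorem4 {Ω : Type*} [MeasurableSpace Ω] (μ : Measure Ω) [IsProbabilityMeasure μ]
    {nx ny : ℕ}
    (X : Ω → EuclideanSpace ℝ (Fin nx)) (Y : Ω → EuclideanSpace ℝ (Fin ny))
    (hX : Measurable X) (hY : Measurable Y)
    (hXY : HasGaussianLaw (fun ω => (X ω, Y ω)) μ)
    (hX0 : μ[X] = 0) (hY0 : μ[Y] = 0)
    (hSX : (DistortionPerception.covMat X X μ).PosDef)
    (hSY : (DistortionPerception.covMat Y Y μ).PosDef) :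
    -- the noise covariance is positive semidefinite
    (DistortionPerception.covW X Y μ).PosSemidef ∧
    ∀ P ∈ Set.Icc (0 : ℝ) (DistortionPerception.Gstar X Y μ),
      -- the conditional distribution has perception index `P` and mean squared error `D(P)`
      (IsMarkovKernel (DistortionPerception.estimatorKernel X Y μ P) ∧
        DistortionPerception.W2 (μ.map X)
          (DistortionPerception.outputLaw (DistortionPerception.estimatorKernel X Y μ P) Y μ) =
            ENNReal.ofReal P ∧
        DistortionPerception.kernelMSE (DistortionPerception.estimatorKernel X Y μ P) X Y μ =
          DistortionPerception.DP X Y μ P) ∧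
      -- so does the random vector built from any noise `W` on the given probability space
      ∀ W : Ω → EuclideanSpace ℝ (Fin nx), DistortionPerception.IsNoise W X Y μ →
        DistortionPerception.IsGeneratedBy
          (fun ω => DistortionPerception.estimate X Y μ P (Y ω) (W ω))
          (DistortionPerception.estimatorKernel X Y μ P) X Y μ ∧
        DistortionPerception.W2 (μ.map X)
          (μ.map (fun ω => DistortionPerception.estimate X Y μ P (Y ω) (W ω))) =
            ENNReal.ofReal P ∧
        ∫⁻ ω, ‖X ω - DistortionPerception.estimate X Y μ P (Y ω) (W ω)‖ₑ ^ 2 ∂μ =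
          DistortionPerception.DP X Y μ P := by
  have h : DistortionPerception.IsGaussianModel X Y μ := ⟨hX, hY, hXY, hX0, hY0, hSX, hSY⟩
  exact ⟨DistortionPerception.posSemidef_covW h, fun P hP =>
    ⟨⟨DistortionPerception.isMarkovKernel_estimatorKernel X Y μ P,
      DistortionPerception.W2_outputLaw_eq h hP, DistortionPerception.kernelMSE_eq_DP h hP⟩,
    fun W hW => DistortionPerception.estimate_optimal h hP hW⟩⟩
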